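/- Let $\mathbf{Z}=(\mathbf{X}_1,A_1,\dots,\mathbf{X}_T,A_T,Y)\sim\mathbb{P}$, where the covariates $\mathbf{X}_t$ take values in standard Borel spaces, the treatments $A_t$ in $\{0,1\}$, and the outcome $Y$ is real with $\mathbb{E}(Y^2)<\infty$. Write $\mathbf{H}_t=(\mathbf{X}_1,\dots,\mathbf{X}_t,A_1,\dots,A_{t-1})$, $\pi_t(\mathbf{h}_t)=\mathbb{P}(A_t=1\mid\mathbf{H}_t=\mathbf{h}_t)$, $\mu(\mathbf{h}_T,a_T)=\mathbb{E}(Y\mid\mathbf{H}_T=\mathbf{h}_T,A_T=a_T)$, fix $\delta\in(0,\infty)$, and for $t=0,\dots,T$ let $$ m_t(\mathbf{h}_t,a_t)=\sum_{a_{t+1},\dots,a_T\in\{0,1\}}\int \mu(\mathbf{h}_T,a_T)\prod_{s=t+1}^T \frac{a_s\delta\pi_s(\mathbf{h}_s)+(1-a_s)\{1-\pi_s(\mathbf{h}_s)\}}{\delta\pi_s(\mathbf{h}_s)+1-\pi_s(\mathbf{h}_s)}\,d\mathbb{P}(\mathbf{x}_s\mid\mathbf{h}_{s-1},a_{s-1}),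 $$ so that $m_T=\mu$. The incremental effect, as a functional of the distribution of the observations, is $\psi(\delta)=\psi(\delta;\mathbb{P})=m_0$. Consider the nonparametric model, with unknown propensity scores. Its smooth submodels at $\mathbb{P}$ are all families $\{\mathbb{P}_\epsilon:\epsilon\in\mathbb{R}\}$ of distributions of $\mathbf{Z}$ that are dominated by a common $\sigma$-finite measure, satisfy $\mathbb{P}_0=\mathbb{P}$, are differentiable in quadratic mean at $\epsilon=0$ with a score $g\in L^2(\mathbb{P})$, and for which $\mathbb{E}_{\mathbb{P}_\epsilon}(Y^2)$ is bounded for $\epsilon$ near $0$. The efficient influence function of $\psi(\delta)$ at $\mathbb{P}$ is the function $\varphi\in L^2(\mathbb{P})$ with $\mathbb{E}\{\varphi(\mathbf{Z})\}=0$ that lies in the $L^2(\mathbb{P})$-closed linear span of the scores of these submodels and satisfies, for each of them, that $\epsilon\mapsto\psi(\delta;\mathbb{P}_\epsilon)$ is differentiable at $0$ with $$\frac{\partial}{\partial\epsilon}\psi(\delta;\mathbb{P}_\epsilon)\Big|_{\epsilon=0}=\mathbb{E}\{\varphi(\mathbf{Z})g(\mathbf{Z})\}.$$ Theorem. The efficient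 influence function of $\psi(\delta)$ exists, is unique up to $\mathbb{P}$-null sets, and is given by $$ \sum_{t=1}^T \frac{1-\delta}{\delta}\Big[A_t\{1-\pi_t(\mathbf{H}_t)\}-(1-A_t)\delta\pi_t(\mathbf{H}_t)\Big]\left[\frac{\delta\pi_t(\mathbf{H}_t)m_t(\mathbf{H}_t,1)+\{1-\pi_t(\mathbf{H}_t)\}m_t(\mathbf{H}_t,0)}{\delta\pi_t(\mathbf{H}_t)+1-\pi_t(\mathbf{H}_t)}\right]\prod_{s=1}^t\frac{\delta A_s+1-A_s}{\delta\pi_s(\mathbf{H}_s)+1-\pi_s(\mathbf{H}_s)} $$ $$ {}+\left\{\prod_{t=1}^T\frac{\delta A_t+1-A_t}{\delta\pi_t(\mathbf{H}_t)+1-\pi_t(\mathbf{H}_t)}\right\}Y-\psi(\delta). $$ -/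

import Mathlib

open MeasureTheory ProbabilityTheory Filter Topology
open scoped NNReal ENNReal

noncomputable section

/-! ### Efficient influence functions -/

namespace Efficiency

variable {Z : Type*} [MeasurableSpace Z]

/-- Density of a probability measure with respect to `ν`, as a real function. -/
def density (P : ProbabilityMeasure Z) (ν : Measure Z) (z : Z) : ℝ :=
  ((P : Measure Z).rnDeriv ν z).toReal

/-- `Q` is a dominated one-dimensional parametric submodel through `P` at parameter value `0`,
differentiable in quadratic mean there, with score `g`:
`∫ ((√p_ε - √p) / ε - g √p / 2)² dν → 0` as `ε → 0`. -/
structure IsSubmodel (P : ProbabilityMeasure Z) (Q : ℝ → ProbabilityMeasure Z) (g : Z → ℝ) :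
    Prop where
  base : Q 0 = P
  score_memLp : MemLp g 2 (P : Measure Z)
  qmd : ∃ ν : Measure Z, SigmaFinite ν ∧ (∀ ε, (Q ε : Measure Z) ≪ ν) ∧
    Tendsto (fun ε : ℝ => eLpNorm (fun z =>
        (√(density (Q ε) ν z) - √(density P ν z)) / ε - g z / 2 * √(density P ν z)) 2 ν)
      (𝓝[≠] 0) (𝓝 0)

/-- `φ` is the efficient influence function at `P` of the parameter `Ψ` in the model whose
submodels through `P`, paired with their scores, are those selected by `S`: an element of the
space of mean-zero finite-variance functions whose covariance with the score of every submodel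
is the derivative of the parameter along the submodel, and which belongs to the tangent space
(the closed linear span of the scores in `L²(P)`). -/
structure IsEIF (S : (ℝ → ProbabilityMeasure Z) → (Z → ℝ) → Prop)
    (Ψ : ProbabilityMeasure Z → ℝ) (P : ProbabilityMeasure Z) (φ : Z → ℝ) : Prop where
  memLp : MemLp φ 2 (P : Measure Z)
  mean_zero : ∫ z, φ z ∂(P : Measure Z) = 0
  pathwise : ∀ Q g, S Q g →
    HasDerivAt (fun ε => Ψ (Q ε)) (∫ z, φ z * g z ∂(P : Measure Z)) 0
  tangent : ∀ η : ℝ≥0∞, 0 < η →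
    ∃ h ∈ Submodule.span ℝ {g : Z → ℝ | ∃ Q, S Q g},
      eLpNorm (fun z => φ z - h z) 2 (P : Measure Z) < η

end Efficiency

/-! ### Longitudinal data and incremental propensity score interventions

Times `1, …, T` are represented by `Fin T`, so that `t : Fin T` is time `t + 1`. -/

namespace Incremental

variable {T : ℕ}

/-- Covariate and treatment trajectories `((x₁, …, x_T), (a₁, …, a_T))`; `true` is treated. -/
abbrev Traj (X : Fin T → Type*) : Type _ := ((t : Fin T) → X t) × (Fin T → Bool)

/-- Observations: covariates and treatments at all times, and the outcome. -/
abbrev Obs (X : Fin T → Type*) : Type _ := Traj X × ℝ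

/-- The numerical value of a treatment. -/
def ind (b : Bool) : ℝ := if b then 1 else 0

variable {X : Fin T → Type*}

/-- The history just prior to treatment at time `t`: covariates up to and including `t`,
treatments before `t`. -/
def hist (t : Fin T) (w : Traj X) : ((s : Set.Iic t) → X s) × (Set.Iio t → Bool) :=
  (fun s => w.1 s, fun s => w.2 s)

/-- Everything prior to the covariates at time `t`: covariates and treatments before `t`. -/
def prev (t : Fin T) (w : Traj X) : ((s : Set.Iio t) → X s) × (Set.Iio t → Bool) :=
  (fun s => w.1 s, fun s => w.2 s)

variable [∀ t, MeasurableSpace (X t)]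

/-- Propensity score `π_t(h_t) = P(A_t = 1 | H_t = h_t)`, as a function of the trajectory (it
depends on the history `h_t` only). -/
def propensity (P : ProbabilityMeasure (Obs X)) (t : Fin T) (w : Traj X) : ℝ :=
  (condDistrib (fun z : Obs X => z.1.2 t) (fun z : Obs X => hist t z.1) (P : Measure (Obs X))
    (hist t w)).real {true}

/-- Outcome regression `μ(h_T, a_T) = E(Y | H_T = h_T, A_T = a_T)`. -/
def outcomeReg (P : ProbabilityMeasure (Obs X)) (w : Traj X) : ℝ :=
  ∫ y, y ∂(condDistrib (fun z : Obs X => z.2) (fun z : Obs X => z.1) (P : Measure (Obs X)) w)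

/-- The conditional distribution `dP(x_t | h_{t-1}, a_{t-1})`. -/
def covLaw [∀ t, StandardBorelSpace (X t)] [∀ t, Nonempty (X t)]
    (P : ProbabilityMeasure (Obs X)) (t : Fin T) (w : Traj X) : Measure (X t) :=
  condDistrib (fun z : Obs X => z.1.1 t) (fun z : Obs X => prev t z.1) (P : Measure (Obs X))
    (prev t w)

/-- `δ π_t(h_t) + 1 - π_t(h_t)`. -/
def denom (δ : ℝ) (P : ProbabilityMeasure (Obs X)) (t : Fin T) (w : Traj X) : ℝ :=
  δ * propensity P t w + 1 - propensity P t w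

/-- Probability of the treatment `a_t` given `h_t` under the incremental intervention,
`(a_t δ π_t + (1 - a_t)(1 - π_t)) / (δ π_t + 1 - π_t)`. -/
def intervention (δ : ℝ) (P : ProbabilityMeasure (Obs X)) (t : Fin T) (w : Traj X) : ℝ :=
  (ind (w.2 t) * δ * propensity P t w + (1 - ind (w.2 t)) * (1 - propensity P t w)) /
    denom δ P t w

/-- The weight `(δ A_t + 1 - A_t) / (δ π_t(H_t) + 1 - π_t(H_t))`. -/
def weight (δ : ℝ) (P : ProbabilityMeasure (Obs X)) (t : Fin T) (w : Traj X) : ℝ :=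
  (δ * ind (w.2 t) + 1 - ind (w.2 t)) / denom δ P t w

/-- Smooth submodels through `P` of the nonparametric model for the observations: arbitrary
submodels differentiable in quadratic mean, the second moment of the outcome being bounded near
parameter value `0`. -/
def Submodel (P : ProbabilityMeasure (Obs X)) (Q : ℝ → ProbabilityMeasure (Obs X))
    (g : Obs X → ℝ) : Prop :=
  Efficiency.IsSubmodel P Q g ∧
    ∃ C : ℝ≥0, ∀ᶠ ε in 𝓝 (0 : ℝ), ∫⁻ z, ‖z.2‖ₑ ^ 2 ∂(Q ε : Measure (Obs X)) ≤ C

variable [∀ t, StandardBorelSpace (X t)] [∀ t, Nonempty (X t)]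

/-- `∫ ∑_{a_t} G dP(x_t | h_{t-1}, a_{t-1})`: integration over the covariates and the treatment
at time `t`. -/
def integrateTime (P : ProbabilityMeasure (Obs X)) (t : Fin T) (G : Traj X → ℝ) (w : Traj X) : ℝ :=
  ∫ x, ∑ b : Bool, G (Function.update w.1 t x, Function.update w.2 t b) ∂(covLaw P t w)

/-- The iterated integral of `F` over covariates and treatments at the times `t + 1, …, T`
(the elements `t, …, T - 1` of `Fin T`), the earliest time outermost. -/
def integrateAfter (P : ProbabilityMeasure (Obs X)) (t : ℕ) (F : Traj X → ℝ) : Traj X → ℝ :=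
  ((List.finRange T).drop t).foldr (integrateTime P) F

/-- The pseudo-regression `m_t(h_t, a_t)` for `t = 0, …, T`, as a function of the trajectory
(it depends on covariates and treatments at the first `t` times only). For `t = T` it is
`outcomeReg`. -/
def pseudoReg (δ : ℝ) (P : ProbabilityMeasure (Obs X)) (t : ℕ) : Traj X → ℝ :=
  integrateAfter P t fun w =>
    outcomeReg P w * ∏ s ∈ Finset.univ.filter (fun s : Fin T => t ≤ (s : ℕ)), intervention δ P s w

/-- The incremental effect `ψ(δ)` as a functional of the distribution of the observations:
`∑_a ∫ μ(h_T, a_T) ∏_t intervention_t dP(x_t | h_{t-1}, a_{t-1})`, which is `m_0`.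
The trajectory at which `m_0` is evaluated is immaterial, see `pseudoReg_zero_eq`. -/
def effect (δ : ℝ) (P : ProbabilityMeasure (Obs X)) : ℝ :=
  pseudoReg δ P 0 (fun t => Classical.arbitrary (X t), fun _ => false)

/-- The explicit function of the observation.
The factor `1 / (δ / (1 - δ))` is written `(1 - δ) / δ`, which also makes sense at `δ = 1`. -/
def eif (δ : ℝ) (P : ProbabilityMeasure (Obs X)) (z : Obs X) : ℝ :=
  ∑ t : Fin T,
      ((ind (z.1.2 t) * (1 - propensity P t z.1)
          - (1 - ind (z.1.2 t)) * δ * propensity P t z.1) * ((1 - δ) / δ)) *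
        ((δ * propensity P t z.1 *
              pseudoReg δ P (t + 1) (z.1.1, Function.update z.1.2 t true)
            + (1 - propensity P t z.1) *
              pseudoReg δ P (t + 1) (z.1.1, Function.update z.1.2 t false)) / denom δ P t z.1) *
        ∏ s ∈ Finset.Iic t, weight δ P s z.1
    + (∏ t : Fin T, weight δ P t z.1) * z.2
    - effect δ P

lemma integrateAfter_congr (P : ProbabilityMeasure (Obs X)) (F : Traj X → ℝ) (n t : ℕ)
    (hn : t + n = T) (w w' : Traj X)
    (h₁ : ∀ s : Fin T, (s : ℕ) < t → w.1 s = w'.1 s)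
    (h₂ : ∀ s : Fin T, (s : ℕ) < t → w.2 s = w'.2 s) :
    integrateAfter P t F w = integrateAfter P t F w' := by
  induction n generalizing t w w' with
  | zero =>
    have : w = w' := Prod.ext (funext fun s => h₁ s (by have := s.2; omega))
      (funext fun s => h₂ s (by have := s.2; omega))
    rw [this]
  | succ n ih =>
    have ht : t < T := by omega
    have hd : integrateAfter P t F = integrateTime P ⟨t, ht⟩ (integrateAfter P (t + 1) F) := by
      unfold integrateAfter
      rw [List.drop_eq_getElem_cons (by simpa using ht), List.foldr_cons]
      simp
    have hp : prev ⟨t, ht⟩ w = prev ⟨t, ht⟩ w' :=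
      Prod.ext (funext fun s => h₁ s s.2) (funext fun s => h₂ s s.2)
    rw [hd]
    unfold integrateTime covLaw
    rw [hp]
    congr 1
    funext x
    refine Finset.sum_congr rfl fun b _ => ih (t + 1) (by omega) _ _ ?_ ?_
    all_goals
      intro s hs
      by_cases hst : s = ⟨t, ht⟩
      · subst hst
        simp
      · have hlt : (s : ℕ) < t := by
          have : (s : ℕ) ≠ t := fun h => hst (Fin.ext h)
          omega
        simp [Function.update_of_ne hst, h₁ s hlt, h₂ s hlt]

lemma pseudoReg_zero_eq (δ : ℝ) (P : ProbabilityMeasure (Obs X)) (w : Traj X) :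
    pseudoReg δ P 0 w = effect δ P :=
  integrateAfter_congr P _ T 0 (by omega) _ _ (by simp) (by simp)

end Incremental

end

/-!
The effect is the mean `ψ = E[∏ₜ Wₜ Y]` of the weighted outcome. Along a submodel with root
densities `r_ε` with respect to `ν`, this is the pairing in `L²(ν)` of `(∏ₜ Wₜ) r_ε` with `Y r_ε`.
The second factor is only bounded in `L²(ν)`, hence converges weakly, so the first one has to be
differentiated in the norm of `L²(ν)`.

The weights depend on `ε` through the propensity scores, which are conditional expectations
`p_ε = E_ε[A | m]`. Subtracting the orthogonality relations satisfied by `A - p_ε` and `A - p_0`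
bounds the difference quotients of `p_ε` and identifies both their weak limit
`E_0[(A - p_0) g | m] r_0` and the limit of their norms, where `g` is the score; the convergence is
therefore strong. As conditional expectation is self-adjoint, each of these derivatives contributes
to that of `ψ` the covariance of `g` with `(Aₜ - πₜ) E[(1 - δ) / Dₜ * ∏ₛ Wₛ Y | Hₜ]`, where `Dₜ` is
the denominator of `Wₜ`; the tower property expresses the last factor through `mₜ`.

Bounded mean-zero functions `h` are scores, namely of the tilts `(1 + ε h) P`, and they are dense
among the mean-zero functions of `L²(P)`, so the tangent space imposes no restriction.
-/

namespace Efficiency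

section L2

variable {Z : Type*} [MeasurableSpace Z] {ν : Measure Z}

lemma memLp_bdd_mul {k u : Z → ℝ} (hu : MemLp u 2 ν) (hk : AEStronglyMeasurable k ν)
    {C : ℝ} (hC : ∀ z, |k z| ≤ C) : MemLp (fun z => k z * u z) 2 ν :=
  hu.of_le_mul (c := C) (hk.mul hu.1) <| .of_forall fun z => by
    rw [norm_mul]
    exact mul_le_mul_of_nonneg_right (hC z) (norm_nonneg _)

lemma integrable_mul_of_memLp_two {u v : Z → ℝ} (hu : MemLp u 2 ν) (hv : MemLp v 2 ν) :
    Integrable (fun z => u z * v z) ν :=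
  hu.integrable_mul hv

lemma eLpNorm_two_eq_ofReal_sqrt {u : Z → ℝ} (hu : MemLp u 2 ν) :
    eLpNorm u 2 ν = ENNReal.ofReal √(∫ z, u z * u z ∂ν) := by
  rw [hu.eLpNorm_eq_integral_rpow_norm (by norm_num) (by norm_num), Real.sqrt_eq_rpow]
  simp [sq]

lemma enorm_integral_mul_le {u v : Z → ℝ} (hu : AEStronglyMeasurable u ν)
    (hv : AEStronglyMeasurable v ν) :
    ‖∫ z, u z * v z ∂ν‖ₑ ≤ eLpNorm u 2 ν * eLpNorm v 2 ν :=
  calc ‖∫ z, u z * v z ∂ν‖ₑ ≤ eLpNorm (u • v) 1 ν := by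
        rw [eLpNorm_one_eq_lintegral_enorm]
        exact enorm_integral_le_lintegral_enorm _
    _ ≤ eLpNorm u 2 ν * eLpNorm v 2 ν := eLpNorm_smul_le_mul_eLpNorm hv hu

lemma eLpNorm_bdd_mul_le {k u : Z → ℝ} {C : ℝ} (hC : ∀ z, |k z| ≤ C) :
    eLpNorm (fun z => k z * u z) 2 ν ≤ ENNReal.ofReal C * eLpNorm u 2 ν :=
  eLpNorm_le_mul_eLpNorm_of_ae_le_mul (.of_forall fun z => by
    rw [norm_mul]
    exact mul_le_mul_of_nonneg_right (hC z) (norm_nonneg _)) 2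

variable {ι κ : Type*} {l : Filter ι} {l' : Filter κ} {k u v : ι → Z → ℝ} {u₀ v₀ : Z → ℝ} {C : ℝ}

/-- The family `v` is eventually bounded in `L²(ν)` along the filter `l`. -/
def L2Bounded (ν : Measure Z) (l : Filter ι) (v : ι → Z → ℝ) : Prop :=
  ∃ C : ℝ≥0, ∀ᶠ i in l, AEStronglyMeasurable (v i) ν ∧ eLpNorm (v i) 2 ν ≤ C

/-- Convergence in `L²(ν)` of the functions `u i` to `u₀` along the filter `l`. Membership of
`u i` in `L²(ν)` is only required, and only true, eventually. -/
structure L2Tendsto (ν : Measure Z) (l : Filter ι) (u : ι → Z → ℝ) (u₀ : Z → ℝ) : Prop where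
  aestronglyMeasurable : ∀ᶠ i in l, AEStronglyMeasurable (u i) ν
  memLp_lim : MemLp u₀ 2 ν
  tendsto : Tendsto (fun i => eLpNorm (fun z => u i z - u₀ z) 2 ν) l (𝓝 0)

namespace L2Bounded

lemma memLp (hv : L2Bounded ν l v) : ∀ᶠ i in l, MemLp (v i) 2 ν := by
  obtain ⟨C, hC⟩ := hv
  exact hC.mono fun i hi => ⟨hi.1, hi.2.trans_lt ENNReal.coe_lt_top⟩

lemma const (h : MemLp v₀ 2 ν) : L2Bounded ν l fun _ => v₀ :=
  ⟨(eLpNorm v₀ 2 ν).toNNReal, .of_forall fun _ => ⟨h.1, (ENNReal.coe_toNNReal h.2.ne).ge⟩⟩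

lemma congr (hu : L2Bounded ν l u) (huv : u =ᶠ[l] v) : L2Bounded ν l v := by
  obtain ⟨C, hC⟩ := hu
  exact ⟨C, (hC.and huv).mono fun i hi => hi.2 ▸ hi.1⟩

lemma comp_tendsto (hv : L2Bounded ν l v) {φ : κ → ι} (hφ : Tendsto φ l' l) :
    L2Bounded ν l' fun j => v (φ j) := by
  obtain ⟨C, hC⟩ := hv
  exact ⟨C, hφ.eventually hC⟩

lemma add (hu : L2Bounded ν l u) (hv : L2Bounded ν l v) :
    L2Bounded ν l fun i z => u i z + v i z := by
  obtain ⟨C, hC⟩ := hu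
  obtain ⟨D, hD⟩ := hv
  refine ⟨C + D, (hC.and hD).mono fun i hi => ⟨hi.1.1.add hi.2.1, ?_⟩⟩
  rw [ENNReal.coe_add]
  exact (eLpNorm_add_le hi.1.1 hi.2.1 (by norm_num)).trans (add_le_add hi.1.2 hi.2.2)

lemma bdd_mul (hv : L2Bounded ν l v) (hk : ∀ᶠ i in l, AEStronglyMeasurable (k i) ν)
    (hC : ∀ᶠ i in l, ∀ z, |k i z| ≤ C) : L2Bounded ν l fun i z => k i z * v i z := by
  obtain ⟨D, hD⟩ := hv
  refine ⟨C.toNNReal * D, ?_⟩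
  filter_upwards [hk, hC, hD] with i hki hCi hDi
  rw [ENNReal.coe_mul]
  exact ⟨hki.mul hDi.1, (eLpNorm_bdd_mul_le hCi).trans (mul_le_mul_right hDi.2 _)⟩

lemma l2Tendsto_zero_of_tendsto_mul (hv : L2Bounded ν l v) {c : ι → ℝ}
    (hc : Tendsto c l (𝓝 0)) : L2Tendsto ν l (fun i z => c i * v i z) 0 := by
  obtain ⟨C, hC⟩ := hv
  refine ⟨hC.mono fun i hi => hi.1.const_mul _, MemLp.zero, ?_⟩
  have hbound : Tendsto (fun i => ‖c i‖ₑ * C) l (𝓝 0) := by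
    simpa using ENNReal.Tendsto.mul_const (continuous_enorm.continuousAt.tendsto.comp hc)
      (.inr (ENNReal.coe_ne_top (r := C)))
  refine tendsto_of_tendsto_of_tendsto_of_le_of_le' tendsto_const_nhds hbound
    (.of_forall fun _ => zero_le) (hC.mono fun i hi => ?_)
  simp only [Pi.zero_apply, sub_zero]
  exact (eLpNorm_const_smul (c i) (v i) 2 ν).le.trans (mul_le_mul_right hi.2 _)

end L2Bounded

namespace L2Tendsto

lemma congr (hu : L2Tendsto ν l u u₀) (huv : u =ᶠ[l] v) : L2Tendsto ν l v u₀ :=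
  ⟨(hu.aestronglyMeasurable.and huv).mono fun _ hi => hi.2 ▸ hi.1, hu.memLp_lim,
    hu.tendsto.congr' (huv.mono fun i hi => by rw [hi])⟩

lemma const (h : MemLp u₀ 2 ν) : L2Tendsto ν l (fun _ => u₀) u₀ :=
  ⟨.of_forall fun _ => h.1, h, by simp [tendsto_const_nhds]⟩

lemma comp_tendsto (hu : L2Tendsto ν l u u₀) {φ : κ → ι} (hφ : Tendsto φ l' l) :
    L2Tendsto ν l' (fun j => u (φ j)) u₀ :=
  ⟨hφ.eventually hu.aestronglyMeasurable, hu.memLp_lim, hu.tendsto.comp hφ⟩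

lemma add (hu : L2Tendsto ν l u u₀) (hv : L2Tendsto ν l v v₀) :
    L2Tendsto ν l (fun i z => u i z + v i z) fun z => u₀ z + v₀ z where
  aestronglyMeasurable :=
    (hu.aestronglyMeasurable.and hv.aestronglyMeasurable).mono fun _ hi => hi.1.add hi.2
  memLp_lim := hu.memLp_lim.add hv.memLp_lim
  tendsto := by
    have hsum := hu.tendsto.add hv.tendsto
    rw [add_zero] at hsum
    refine tendsto_of_tendsto_of_tendsto_of_le_of_le' tendsto_const_nhds hsum
      (.of_forall fun _ => zero_le) ?_
    filter_upwards [hu.aestronglyMeasurable, hv.aestronglyMeasurable] with i hui hvi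
    simp_rw [add_sub_add_comm]
    exact eLpNorm_add_le (hui.sub hu.memLp_lim.1) (hvi.sub hv.memLp_lim.1) (by norm_num)

lemma bdd_mul (hu : L2Tendsto ν l u 0) (hk : ∀ᶠ i in l, AEStronglyMeasurable (k i) ν)
    (hC : ∀ᶠ i in l, ∀ z, |k i z| ≤ C) : L2Tendsto ν l (fun i z => k i z * u i z) 0 where
  aestronglyMeasurable := (hk.and hu.aestronglyMeasurable).mono fun _ hi => hi.1.mul hi.2
  memLp_lim := MemLp.zero
  tendsto := by
    have hbound := ENNReal.Tendsto.const_mul hu.tendsto (.inr (ENNReal.ofReal_ne_top (r := C)))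
    rw [mul_zero] at hbound
    refine tendsto_of_tendsto_of_tendsto_of_le_of_le' tendsto_const_nhds hbound
      (.of_forall fun _ => zero_le) (hC.mono fun i hi => ?_)
    simp only [Pi.zero_apply, sub_zero]
    exact eLpNorm_bdd_mul_le hi

lemma sub_lim (hu : L2Tendsto ν l u u₀) : L2Tendsto ν l (fun i z => u i z - u₀ z) 0 :=
  ⟨hu.aestronglyMeasurable.mono fun _ hi => hi.sub hu.memLp_lim.1, MemLp.zero,
    by simpa using hu.tendsto⟩

lemma of_sub (h₀ : MemLp u₀ 2 ν) (hu : L2Tendsto ν l (fun i z => u i z - u₀ z) 0) :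
    L2Tendsto ν l u u₀ := by
  simpa [Pi.zero_def] using hu.add (const h₀)

lemma const_bdd_mul {f : Z → ℝ} (hu : L2Tendsto ν l u u₀) (hf : AEStronglyMeasurable f ν)
    (hC : ∀ z, |f z| ≤ C) : L2Tendsto ν l (fun i z => f z * u i z) fun z => f z * u₀ z :=
  .of_sub (memLp_bdd_mul hu.memLp_lim hf hC) <| by
    simpa only [mul_sub] using hu.sub_lim.bdd_mul (k := fun _ => f) (.of_forall fun _ => hf)
      (.of_forall fun _ => hC)

lemma l2Bounded (hu : L2Tendsto ν l u u₀) : L2Bounded ν l u := by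
  have hsub : L2Bounded ν l fun i z => u i z - u₀ z := by
    refine ⟨1, ?_⟩
    filter_upwards [hu.aestronglyMeasurable, hu.tendsto.eventually_le_const one_pos] with i hui hi
    exact ⟨hui.sub hu.memLp_lim.1, by simpa using hi⟩
  simpa using hsub.add (L2Bounded.const hu.memLp_lim)

lemma of_integral_mul_self (hu : ∀ᶠ i in l, MemLp (u i) 2 ν)
    (h : Tendsto (fun i => ∫ z, u i z * u i z ∂ν) l (𝓝 0)) : L2Tendsto ν l u 0 := by
  refine ⟨hu.mono fun _ hi => hi.1, MemLp.zero, ?_⟩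
  have hlim : Tendsto (fun i => ENNReal.ofReal √(∫ z, u i z * u i z ∂ν)) l (𝓝 0) := by
    simpa using ENNReal.tendsto_ofReal h.sqrt
  exact hlim.congr' (hu.mono fun i hi => by simp [eLpNorm_two_eq_ofReal_sqrt hi])

lemma tendsto_integral_mul_zero (hu : L2Tendsto ν l u 0) (hv : L2Bounded ν l v) :
    Tendsto (fun i => ∫ z, u i z * v i z ∂ν) l (𝓝 0) := by
  obtain ⟨C, hC⟩ := hv
  rw [tendsto_zero_iff_enorm_tendsto_zero]
  have hbound := ENNReal.Tendsto.mul_const hu.tendsto (.inr (ENNReal.coe_ne_top (r := C)))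
  simp only [Pi.zero_apply, sub_zero, zero_mul] at hbound
  refine tendsto_of_tendsto_of_tendsto_of_le_of_le' tendsto_const_nhds hbound
    (.of_forall fun _ => zero_le) ?_
  filter_upwards [hu.aestronglyMeasurable, hC] with i hui hvi
  exact (enorm_integral_mul_le hui hvi.1).trans (mul_le_mul_right hvi.2 _)

lemma tendsto_integral_mul {c : ℝ} (hu : L2Tendsto ν l u u₀) (hv : L2Bounded ν l v)
    (hw : Tendsto (fun i => ∫ z, u₀ z * v i z ∂ν) l (𝓝 c)) :
    Tendsto (fun i => ∫ z, u i z * v i z ∂ν) l (𝓝 c) := by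
  have hsum := (hu.sub_lim.tendsto_integral_mul_zero hv).add hw
  rw [zero_add] at hsum
  refine hsum.congr' ?_
  filter_upwards [hu.sub_lim.l2Bounded.memLp, hv.memLp] with i hui hvi
  rw [← integral_add (integrable_mul_of_memLp_two hui hvi)
    (integrable_mul_of_memLp_two hu.memLp_lim hvi)]
  exact integral_congr_ae (.of_forall fun z => by dsimp only; ring)

/-- The Radon–Riesz property of `L²`. -/
lemma of_tendsto_integral (hv : ∀ᶠ i in l, MemLp (v i) 2 ν) (hv₀ : MemLp v₀ 2 ν)
    (hnorm : Tendsto (fun i => ∫ z, v i z * v i z ∂ν) l (𝓝 (∫ z, v₀ z * v₀ z ∂ν)))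
    (hweak : Tendsto (fun i => ∫ z, v₀ z * v i z ∂ν) l (𝓝 (∫ z, v₀ z * v₀ z ∂ν))) :
    L2Tendsto ν l v v₀ := by
  refine of_sub hv₀ (of_integral_mul_self (hv.mono fun i hi => hi.sub hv₀) ?_)
  have hexp := (hnorm.sub (hweak.const_mul 2)).add_const (∫ z, v₀ z * v₀ z ∂ν)
  rw [show ∀ c : ℝ, c - 2 * c + c = 0 by intro c; ring] at hexp
  refine hexp.congr' (hv.mono fun i hi => ?_)
  have hvv := integrable_mul_of_memLp_two hi hi
  have hvv₀ := (integrable_mul_of_memLp_two hv₀ hi).const_mul 2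
  have hsub : Integrable (fun z => v i z * v i z - 2 * (v₀ z * v i z)) ν := hvv.sub hvv₀
  rw [← integral_const_mul, ← integral_sub hvv hvv₀,
    ← integral_add hsub (integrable_mul_of_memLp_two hv₀ hv₀)]
  exact integral_congr_ae (.of_forall fun z => by dsimp only; ring)

lemma indicator_abs_le {f Y : Z → ℝ} (hf : MemLp f 2 ν) (hY : Measurable Y) :
    L2Tendsto ν atTop (fun (n : ℕ) z => {z | |Y z| ≤ n}.indicator f z) f := by
  have hset : ∀ n : ℕ, MeasurableSet {z | |Y z| ≤ n} := fun n =>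
    measurableSet_le hY.abs measurable_const
  have hmem : ∀ n : ℕ, MemLp (fun z => {z | |Y z| ≤ n}.indicator f z - f z) 2 ν := fun n =>
    (hf.indicator (hset n)).sub hf
  refine of_sub hf (of_integral_mul_self (.of_forall hmem) ?_)
  rw [← integral_zero Z ℝ (μ := ν)]
  refine tendsto_integral_of_dominated_convergence (fun z => f z ^ 2)
    (fun n => (integrable_mul_of_memLp_two (hmem n) (hmem n)).1) hf.integrable_sq
    (fun n => .of_forall fun z => ?_) (.of_forall fun z => ?_)
  · by_cases hz : |Y z| ≤ n
    · simp [hz, sq_nonneg]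
    · simp [hz, sq]
  · refine tendsto_const_nhds.congr' ?_
    filter_upwards [tendsto_natCast_atTop_atTop.eventually_ge_atTop |Y z|] with n hn
    simp [hn]

lemma tendsto_integral_lim_mul [NeBot l'] {f : κ → Z → ℝ} {f₀ : Z → ℝ}
    (hf : L2Tendsto ν l' f f₀) (hv : L2Bounded ν l v) (hv₀ : MemLp v₀ 2 ν)
    (h : ∀ j, Tendsto (fun i => ∫ z, f j z * v i z ∂ν) l (𝓝 (∫ z, f j z * v₀ z ∂ν))) :
    Tendsto (fun i => ∫ z, f₀ z * v i z ∂ν) l (𝓝 (∫ z, f₀ z * v₀ z ∂ν)) := by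
  have hunif : TendstoUniformlyOnFilter (fun j i => ∫ z, f j z * v i z ∂ν)
      (fun i => ∫ z, f₀ z * v i z ∂ν) l' l := by
    have hdiff := (hf.comp_tendsto (tendsto_fst (g := l))).sub_lim.tendsto_integral_mul_zero
      (hv.comp_tendsto (tendsto_snd (f := l')))
    rw [Metric.tendstoUniformlyOnFilter_iff]
    intro η hη
    have hmem := (hf.comp_tendsto (tendsto_fst (g := l))).l2Bounded.memLp
    filter_upwards [hdiff.norm.eventually_lt_const (by simpa using hη), hmem,
      tendsto_snd.eventually hv.memLp] with p hp hfp hvp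
    rw [dist_comm, Real.dist_eq, ← integral_sub (integrable_mul_of_memLp_two hfp hvp)
      (integrable_mul_of_memLp_two hf.memLp_lim hvp)]
    simpa only [sub_mul, Real.norm_eq_abs] using hp
  exact hunif.tendsto_of_eventually_tendsto (.of_forall h)
    (hf.tendsto_integral_mul (L2Bounded.const hv₀) tendsto_const_nhds)

lemma of_approx [NeBot l'] {w : κ → ι → Z → ℝ} (hw : ∀ j, L2Tendsto ν l (w j) 0)
    (hu : ∀ᶠ i in l, AEStronglyMeasurable (u i) ν)
    (h : L2Tendsto ν (l' ×ˢ l) (fun p z => u p.2 z - w p.1 p.2 z) 0) : L2Tendsto ν l u 0 := by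
  refine ⟨hu, MemLp.zero, ENNReal.tendsto_nhds_zero.2 fun η hη => ?_⟩
  have hη₂ : 0 < η / 2 := ENNReal.half_pos hη.ne'
  obtain ⟨j, hj⟩ := (h.tendsto.eventually_le_const hη₂).curry.exists
  filter_upwards [hj, (hw j).tendsto.eventually_le_const hη₂, hu, (hw j).aestronglyMeasurable]
    with i herr hwi hui hwm
  simp only [Pi.zero_apply, sub_zero] at herr hwi ⊢
  calc eLpNorm (u i) 2 ν
      ≤ eLpNorm (fun z => u i z - w j i z) 2 ν + eLpNorm (w j i) 2 ν := by
        conv_lhs => rw [← sub_add_cancel (u i) (w j i)]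
        exact eLpNorm_add_le (hui.sub hwm) hwm (by norm_num)
    _ ≤ η / 2 + η / 2 := add_le_add herr hwi
    _ = η := ENNReal.add_halves η

lemma bdd_mul_lim {f r : Z → ℝ} (hkr : L2Tendsto ν l (fun i z => k i z * r z) 0)
    (hk : ∀ᶠ i in l, AEStronglyMeasurable (k i) ν) (hC : ∀ᶠ i in l, ∀ z, |k i z| ≤ C)
    (hf : Measurable f) (hfr : MemLp (fun z => f z * r z) 2 ν) :
    L2Tendsto ν l (fun i z => k i z * (f z * r z)) 0 := by
  have hset : ∀ n : ℕ, MeasurableSet {z | |f z| ≤ n} := fun n =>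
    measurableSet_le hf.abs measurable_const
  have htrunc := indicator_abs_le hfr hf
  refine of_approx (l' := atTop) (w := fun (n : ℕ) i z =>
    {z | |f z| ≤ n}.indicator f z * (k i z * r z)) (fun n => ?_)
    (hk.mono fun i hi => hi.mul hfr.1) ?_
  · refine hkr.bdd_mul (C := n) (.of_forall fun _ => (hf.indicator (hset n)).aestronglyMeasurable)
      (.of_forall fun _ z => ?_)
    by_cases hz : |f z| ≤ n <;> simp [hz]
  · refine ((htrunc.comp_tendsto (tendsto_fst (g := l))).sub_lim.bdd_mul (C := C)
      (k := fun p z => -k p.2 z) (tendsto_snd.eventually (hk.mono fun i hi => hi.neg))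
      (tendsto_snd.eventually (hC.mono fun i hi z => (abs_neg (k i z)).trans_le (hi z)))).congr
      (.of_forall fun p => funext fun z => ?_)
    by_cases hz : z ∈ {z | |f z| ≤ p.1}
    · simp only [Set.indicator_of_mem hz]
      ring
    · simp [Set.indicator_of_notMem hz]

lemma bdd_mul_of_mul_tendsto {f r : Z → ℝ} (hu : L2Tendsto ν l u fun z => f z * r z)
    (hkr : L2Tendsto ν l (fun i z => k i z * r z) 0)
    (hk : ∀ᶠ i in l, AEStronglyMeasurable (k i) ν) (hC : ∀ᶠ i in l, ∀ z, |k i z| ≤ C)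
    (hf : Measurable f) : L2Tendsto ν l (fun i z => k i z * u i z) 0 := by
  simpa [mul_sub, Pi.zero_def] using
    (hu.sub_lim.bdd_mul hk hC).add (hkr.bdd_mul_lim hk hC hf hu.memLp_lim)

end L2Tendsto

end L2

section RootModel

variable {Z : Type*}

/-- The difference quotient at `0` of a family of functions indexed by a real parameter. -/
noncomputable def diffQuot (k : ℝ → Z → ℝ) (ε : ℝ) (z : Z) : ℝ := (k ε z - k 0 z) / ε

lemma mul_diffQuot (k : ℝ → Z → ℝ) {ε : ℝ} (hε : ε ≠ 0) (z : Z) :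
    ε * diffQuot k ε z = k ε z - k 0 z :=
  mul_div_cancel₀ _ hε

variable [mZ : MeasurableSpace Z]

lemma measurable_diffQuot {k : ℝ → Z → ℝ} (hk : ∀ ε, Measurable (k ε)) (ε : ℝ) :
    Measurable (diffQuot k ε) :=
  ((hk ε).sub (hk 0)).div_const ε

/-- A one-dimensional family of distributions `Q ε` whose densities with respect to `ν` are the
squares of the root densities `r ε`, differentiable in quadratic mean at `0` with the measurable
score `g`. -/
structure RootModel (ν : Measure Z) (r : ℝ → Z → ℝ) (Q : ℝ → ProbabilityMeasure Z)
    (g : Z → ℝ) : Prop where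
  measurable_root : ∀ ε, Measurable (r ε)
  law : ∀ ε, (Q ε : Measure Z) = ν.withDensity fun z => ‖r ε z‖ₑ ^ 2
  measurable_score : Measurable g
  tendsto : L2Tendsto ν (𝓝[≠] 0) (diffQuot r) fun z => g z / 2 * r 0 z

lemma withDensity_enorm_sqrt_density {P : ProbabilityMeasure Z} {ν : Measure Z} [SigmaFinite ν]
    (h : (P : Measure Z) ≪ ν) :
    (P : Measure Z) = ν.withDensity fun z => ‖√(density P ν z)‖ₑ ^ 2 := by
  conv_lhs => rw [← Measure.withDensity_rnDeriv_eq _ _ h]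
  refine withDensity_congr_ae ?_
  filter_upwards [Measure.rnDeriv_lt_top (P : Measure Z) ν] with z hz
  rw [density, sq, ← enorm_mul, Real.mul_self_sqrt ENNReal.toReal_nonneg,
    Real.enorm_of_nonneg ENNReal.toReal_nonneg, ENNReal.ofReal_toReal hz.ne]

lemma eLpNorm_withDensity_enorm_sq {ν : Measure Z} {f r : Z → ℝ} (hf : Measurable f)
    (hr : Measurable r) :
    eLpNorm f 2 (ν.withDensity fun z => ‖r z‖ₑ ^ 2) = eLpNorm (fun z => f z * r z) 2 ν := by
  simp_rw [eLpNorm_eq_lintegral_rpow_enorm_toReal two_ne_zero ENNReal.ofNat_ne_top,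
    ENNReal.toReal_ofNat, ENNReal.rpow_ofNat]
  rw [lintegral_withDensity_eq_lintegral_mul _ (by fun_prop) (by fun_prop)]
  simp_rw [Pi.mul_apply, enorm_mul, mul_pow, mul_comm]

lemma memLp_withDensity_enorm_sq_iff {ν : Measure Z} {f r : Z → ℝ} (hf : Measurable f)
    (hr : Measurable r) :
    MemLp f 2 (ν.withDensity fun z => ‖r z‖ₑ ^ 2) ↔ MemLp (fun z => f z * r z) 2 ν := by
  have hfr : AEStronglyMeasurable (fun z => f z * r z) ν := (hf.mul hr).aestronglyMeasurable
  simp only [MemLp, eLpNorm_withDensity_enorm_sq hf hr, hf.aestronglyMeasurable, hfr, true_and]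

namespace RootModel

variable {ν : Measure Z} {r : ℝ → Z → ℝ} {Q : ℝ → ProbabilityMeasure Z} {g : Z → ℝ}

lemma integral_mul_eq (M : RootModel ν r Q g) (ε : ℝ) (f h : Z → ℝ) :
    ∫ z, f z * h z ∂(Q ε : Measure Z) = ∫ z, (f z * r ε z) * (h z * r ε z) ∂ν := by
  have hr := M.measurable_root ε
  rw [M.law, integral_withDensity_eq_integral_toReal_smul (by fun_prop)
    (.of_forall fun z => ENNReal.pow_lt_top enorm_lt_top)]
  refine integral_congr_ae (.of_forall fun z => ?_)
  simp only [ENNReal.toReal_pow, toReal_enorm, Real.norm_eq_abs, sq_abs, smul_eq_mul]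
  ring

lemma memLp_mul_iff (M : RootModel ν r Q g) {ε : ℝ} {f : Z → ℝ} (hf : Measurable f) :
    MemLp (fun z => f z * r ε z) 2 ν ↔ MemLp f 2 (Q ε : Measure Z) := by
  rw [M.law, memLp_withDensity_enorm_sq_iff hf (M.measurable_root ε)]

lemma memLp_root (M : RootModel ν r Q g) (ε : ℝ) : MemLp (r ε) 2 ν := by
  simpa using (M.memLp_mul_iff (ε := ε) (f := fun _ => 1) measurable_const).2 (memLp_const 1)

lemma memLp_diffQuot (M : RootModel ν r Q g) (ε : ℝ) : MemLp (diffQuot r ε) 2 ν := by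
  have h := ((M.memLp_root ε).sub (M.memLp_root 0)).const_mul ε⁻¹
  simp only [Pi.sub_apply, ← div_eq_inv_mul] at h
  exact h

lemma memLp_score (M : RootModel ν r Q g) : MemLp g 2 (Q 0 : Measure Z) := by
  have h := (M.memLp_mul_iff (M.measurable_score.div_const 2)).1 M.tendsto.memLp_lim
  simpa [mul_div_cancel₀] using h.const_mul 2

lemma l2Tendsto_root (M : RootModel ν r Q g) : L2Tendsto ν (𝓝[≠] 0) r (r 0) := by
  have hid : Tendsto (fun ε : ℝ => ε) (𝓝[≠] 0) (𝓝 0) := tendsto_id.mono_left nhdsWithin_le_nhds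
  refine .of_sub (M.memLp_root 0)
    ((M.tendsto.l2Bounded.l2Tendsto_zero_of_tendsto_mul hid).congr ?_)
  filter_upwards [self_mem_nhdsWithin] with ε hε
  exact funext (mul_diffQuot r hε)

lemma l2Tendsto_mul_root_sub (M : RootModel ν r Q g) {f : ℝ → Z → ℝ} (hf : ∀ ε, Measurable (f ε))
    {C : ℝ} (hC : ∀ᶠ ε in 𝓝[≠] 0, ∀ z, |ε * f ε z| ≤ C)
    (hf₀ : L2Bounded ν (𝓝[≠] 0) fun ε z => f ε z * r 0 z) :
    L2Tendsto ν (𝓝[≠] 0) (fun ε z => f ε z * (r ε z - r 0 z)) 0 := by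
  have hid : Tendsto (fun ε : ℝ => ε) (𝓝[≠] 0) (𝓝 0) := tendsto_id.mono_left nhdsWithin_le_nhds
  have hzero : L2Tendsto ν (𝓝[≠] 0) (fun ε z => (ε * f ε z) * r 0 z) 0 := by
    simpa only [mul_assoc] using hf₀.l2Tendsto_zero_of_tendsto_mul hid
  refine (M.tendsto.bdd_mul_of_mul_tendsto hzero
    (.of_forall fun ε => ((hf ε).const_mul ε).aestronglyMeasurable) hC
    (M.measurable_score.div_const 2)).congr ?_
  filter_upwards [self_mem_nhdsWithin] with ε hε
  funext z
  rw [← mul_diffQuot r hε]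
  ring

end RootModel

lemma IsSubmodel.exists_rootModel {P : ProbabilityMeasure Z} {Q : ℝ → ProbabilityMeasure Z}
    {g : Z → ℝ} (h : IsSubmodel P Q g) :
    ∃ (ν : Measure Z) (r : ℝ → Z → ℝ) (g' : Z → ℝ), g =ᵐ[(P : Measure Z)] g' ∧
      RootModel ν r Q g' := by
  obtain ⟨rfl, hg, ν, hν, hac, hqmd⟩ := h
  obtain ⟨g', hg', hgg'⟩ := hg.1
  set r : ℝ → Z → ℝ := fun ε z => √(density (Q ε) ν z)
  have hr : ∀ ε, Measurable (r ε) := fun ε =>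
    (Measure.measurable_rnDeriv _ _).ennreal_toReal.sqrt
  have hlaw : ∀ ε, (Q ε : Measure Z) = ν.withDensity fun z => ‖r ε z‖ₑ ^ 2 := fun ε =>
    withDensity_enorm_sqrt_density (hac ε)
  refine ⟨ν, r, g', hgg', hr, hlaw, hg'.measurable,
    .of_forall fun ε => (measurable_diffQuot hr ε).aestronglyMeasurable,
    (memLp_withDensity_enorm_sq_iff (hg'.measurable.div_const 2) (hr 0)).1 ?_,
    hqmd.congr fun ε => eLpNorm_congr_ae ?_⟩
  · simpa only [← hlaw, div_eq_inv_mul] using ((memLp_congr_ae hgg').1 hg).const_mul 2⁻¹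
  · rw [hlaw 0] at hgg'
    have hr₀ := hr 0
    filter_upwards [(ae_withDensity_iff (by fun_prop)).1 hgg'] with z hz
    by_cases h₀ : r 0 z = 0
    · simp [diffQuot, r, show √(density (Q 0) ν z) = 0 from h₀]
    · rw [← hz (by simpa using h₀), diffQuot]

end RootModel

section CondExp

variable {Z : Type*} {m : MeasurableSpace Z} [mZ : MeasurableSpace Z]

lemma integral_mul_condExp {μ : Measure Z} [IsFiniteMeasure μ] (hm : m ≤ mZ) {f u : Z → ℝ}
    (hf : StronglyMeasurable[m] f) (hu : Integrable u μ)
    (hfu : Integrable (fun z => f z * u z) μ) :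
    ∫ z, f z * (μ[u | m]) z ∂μ = ∫ z, f z * u z ∂μ :=
  calc ∫ z, f z * (μ[u | m]) z ∂μ = ∫ z, (μ[fun z => f z * u z | m]) z ∂μ :=
        integral_congr_ae (condExp_mul_of_stronglyMeasurable_left hf hfu hu).symm
    _ = ∫ z, f z * u z ∂μ := integral_condExp hm

lemma integral_condExp_mul {μ : Measure Z} [IsFiniteMeasure μ] (hm : m ≤ mZ) {u v : Z → ℝ}
    (hu : MemLp u 2 μ) (hv : MemLp v 2 μ) :
    ∫ z, (μ[u | m]) z * v z ∂μ = ∫ z, u z * (μ[v | m]) z ∂μ := by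
  have hcu : MemLp (μ[u | m]) 2 μ := hu.condExp one_le_two
  have hcv : MemLp (μ[v | m]) 2 μ := hv.condExp one_le_two
  calc ∫ z, (μ[u | m]) z * v z ∂μ = ∫ z, (μ[u | m]) z * (μ[v | m]) z ∂μ :=
        (integral_mul_condExp hm stronglyMeasurable_condExp (hv.integrable one_le_two)
          (integrable_mul_of_memLp_two hcu hv)).symm
    _ = ∫ z, (μ[v | m]) z * (μ[u | m]) z ∂μ := by simp only [mul_comm]
    _ = ∫ z, (μ[v | m]) z * u z ∂μ :=
        integral_mul_condExp hm stronglyMeasurable_condExp (hu.integrable one_le_two)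
          (integrable_mul_of_memLp_two hcv hu)
    _ = ∫ z, u z * (μ[v | m]) z ∂μ := by simp only [mul_comm]

variable (m) in
/-- The conditional covariance given `m`, under `P`, of `g` with a variable `A` whose conditional
mean is `p`. -/
noncomputable def condCov (P : ProbabilityMeasure Z) (A p g : Z → ℝ) : Z → ℝ :=
  (P : Measure Z)[fun z => (A z - p z) * g z | m]

variable (m) in
/-- The functions `p ε` are versions, with values in `[0, 1]`, of the conditional expectations
under `Q ε` of a variable `A` with values in `[0, 1]`, given the sub-σ-algebra `m`. -/
structure IsCondExpFamily (Q : ℝ → ProbabilityMeasure Z) (A : Z → ℝ) (p : ℝ → Z → ℝ) :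
    Prop where
  le : m ≤ mZ
  measurable_var : Measurable A
  var_mem : ∀ z, A z ∈ Set.Icc (0 : ℝ) 1
  stronglyMeasurable : ∀ ε, StronglyMeasurable[m] (p ε)
  mem : ∀ ε z, p ε z ∈ Set.Icc (0 : ℝ) 1
  condExp_ae_eq : ∀ ε, (Q ε : Measure Z)[A | m] =ᵐ[(Q ε : Measure Z)] p ε

namespace IsCondExpFamily

variable {Q : ℝ → ProbabilityMeasure Z} {A : Z → ℝ} {p : ℝ → Z → ℝ}

lemma measurable (H : IsCondExpFamily m Q A p) (ε : ℝ) : Measurable (p ε) :=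
  ((H.stronglyMeasurable ε).mono H.le).measurable

lemma abs_residual_le (H : IsCondExpFamily m Q A p) (ε : ℝ) (z : Z) : |A z - p ε z| ≤ 1 :=
  abs_sub_le_of_nonneg_of_le (H.var_mem z).1 (H.var_mem z).2 (H.mem ε z).1 (H.mem ε z).2

lemma measurable_residual (H : IsCondExpFamily m Q A p) (ε : ℝ) :
    Measurable fun z => A z - p ε z :=
  H.measurable_var.sub (H.measurable ε)

lemma stronglyMeasurable_diffQuot (H : IsCondExpFamily m Q A p) (ε : ℝ) :
    StronglyMeasurable[m] (diffQuot p ε) :=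
  (((H.stronglyMeasurable ε).measurable.sub (H.stronglyMeasurable 0).measurable).div_const
    ε).stronglyMeasurable

lemma abs_diffQuot_le (H : IsCondExpFamily m Q A p) (ε : ℝ) (z : Z) :
    |diffQuot p ε z| ≤ |ε|⁻¹ := by
  rw [diffQuot, abs_div, div_eq_mul_inv]
  exact mul_le_of_le_one_left (by positivity)
    (abs_sub_le_of_nonneg_of_le (H.mem ε z).1 (H.mem ε z).2 (H.mem 0 z).1 (H.mem 0 z).2)

lemma abs_mul_diffQuot_le (H : IsCondExpFamily m Q A p) (ε : ℝ) (z : Z) :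
    |ε * diffQuot p ε z| ≤ 1 := by
  rw [abs_mul]
  exact (mul_le_mul_of_nonneg_left (H.abs_diffQuot_le ε z) (abs_nonneg ε)).trans mul_inv_le_one

variable {ν : Measure Z} {r : ℝ → Z → ℝ} {g f : Z → ℝ} {C : ℝ}

lemma memLp_residual_mul {u : Z → ℝ} (H : IsCondExpFamily m Q A p) (hu : MemLp u 2 ν) (ε : ℝ) :
    MemLp (fun z => (A z - p ε z) * u z) 2 ν :=
  memLp_bdd_mul hu (H.measurable_residual ε).aestronglyMeasurable (H.abs_residual_le ε)

lemma memLp_diffQuot_mul {u : Z → ℝ} (H : IsCondExpFamily m Q A p) (hu : MemLp u 2 ν) (ε : ℝ) :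
    MemLp (fun z => diffQuot p ε z * u z) 2 ν :=
  memLp_bdd_mul hu (measurable_diffQuot H.measurable ε).aestronglyMeasurable (H.abs_diffQuot_le ε)

lemma integral_residual_mul (H : IsCondExpFamily m Q A p) (M : RootModel ν r Q g)
    (hf : StronglyMeasurable[m] f) (hC : ∀ z, |f z| ≤ C) (ε : ℝ) :
    ∫ z, ((A z - p ε z) * r ε z) * (f z * r ε z) ∂ν = 0 := by
  have hfm : AEStronglyMeasurable f (Q ε : Measure Z) := (hf.mono H.le).aestronglyMeasurable
  have hA : Integrable A (Q ε : Measure Z) :=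
    .of_mem_Icc 0 1 H.measurable_var.aemeasurable (.of_forall H.var_mem)
  have hp : Integrable (p ε) (Q ε : Measure Z) :=
    .of_mem_Icc 0 1 (H.measurable ε).aemeasurable (.of_forall (H.mem ε))
  have hfA : Integrable (fun z => f z * A z) (Q ε : Measure Z) := hA.bdd_mul hfm (.of_forall hC)
  rw [← M.integral_mul_eq]
  calc ∫ z, (A z - p ε z) * f z ∂(Q ε : Measure Z)
      = ∫ z, f z * A z ∂(Q ε : Measure Z) - ∫ z, f z * p ε z ∂(Q ε : Measure Z) := by
        rw [← integral_sub hfA (hp.bdd_mul hfm (.of_forall hC))]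
        exact integral_congr_ae (.of_forall fun z => by dsimp only; ring)
    _ = 0 := by
        rw [← integral_mul_condExp H.le hf hA hfA, sub_eq_zero]
        exact integral_congr_ae ((H.condExp_ae_eq ε).mono fun z hz => by dsimp only; rw [hz])

lemma integral_diffQuot_mul (H : IsCondExpFamily m Q A p) (M : RootModel ν r Q g)
    (hf : StronglyMeasurable[m] f) (hC : ∀ z, |f z| ≤ C) {ε : ℝ} (hε : ε ≠ 0) :
    ∫ z, (diffQuot p ε z * r ε z) * (f z * r ε z) ∂ν =
      ∫ z, ((A z - p 0 z) * diffQuot r ε z) * (f z * r ε z + f z * r 0 z) ∂ν := by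
  have hfr : ∀ ε, MemLp (fun z => f z * r ε z) 2 ν := fun ε =>
    memLp_bdd_mul (M.memLp_root ε) (hf.mono H.le).aestronglyMeasurable hC
  have hres : ∀ ε, Integrable (fun z => ((A z - p ε z) * r ε z) * (f z * r ε z)) ν := fun ε =>
    integrable_mul_of_memLp_two (H.memLp_residual_mul (M.memLp_root ε) ε) (hfr ε)
  have hquot := integrable_mul_of_memLp_two (H.memLp_diffQuot_mul (M.memLp_root ε) ε) (hfr ε)
  have hdiff := integrable_mul_of_memLp_two (H.memLp_residual_mul (M.memLp_diffQuot ε) 0)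
    (v := fun z => f z * r ε z + f z * r 0 z) ((hfr ε).add (hfr 0))
  rw [← sub_eq_zero]
  calc _ = ∫ z, ε⁻¹ * (((A z - p 0 z) * r 0 z) * (f z * r 0 z) -
        ((A z - p ε z) * r ε z) * (f z * r ε z)) ∂ν := by
        rw [← integral_sub hquot hdiff]
        refine integral_congr_ae (.of_forall fun z => ?_)
        simp only [diffQuot]
        field
    _ = 0 := by
        rw [integral_const_mul, integral_sub (hres 0) (hres ε), H.integral_residual_mul M hf hC,
          H.integral_residual_mul M hf hC, sub_zero, mul_zero]

lemma stronglyMeasurable_condCov : StronglyMeasurable[m] (condCov m (Q 0) A (p 0) g) :=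
  stronglyMeasurable_condExp

lemma memLp_condCov_mul_root (H : IsCondExpFamily m Q A p) (M : RootModel ν r Q g) :
    MemLp (fun z => condCov m (Q 0) A (p 0) g z * r 0 z) 2 ν :=
  (M.memLp_mul_iff (stronglyMeasurable_condExp.mono H.le).measurable).2
    (MemLp.condExp (by norm_num) (H.memLp_residual_mul M.memLp_score 0))

lemma condCov_one (H : IsCondExpFamily m Q A p) :
    condCov m (Q 0) A (p 0) (fun _ => 1) =ᵐ[(Q 0 : Measure Z)] fun _ => 0 := by
  have hA : Integrable A (Q 0 : Measure Z) :=
    .of_mem_Icc 0 1 H.measurable_var.aemeasurable (.of_forall H.var_mem)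
  have hp : Integrable (p 0) (Q 0 : Measure Z) :=
    .of_mem_Icc 0 1 (H.measurable 0).aemeasurable (.of_forall (H.mem 0))
  have hsub := condExp_sub hA hp m
  rw [condExp_of_stronglyMeasurable H.le (H.stronglyMeasurable 0) hp] at hsub
  filter_upwards [hsub, H.condExp_ae_eq 0] with z hz hz'
  simp only [condCov, mul_one]
  exact hz.trans (by rw [Pi.sub_apply, hz', sub_self])

lemma integral_condCov_mul (H : IsCondExpFamily m Q A p) (M : RootModel ν r Q g)
    (hf : StronglyMeasurable[m] f) (hC : ∀ z, |f z| ≤ C) :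
    2 * ∫ z, ((A z - p 0 z) * (g z / 2 * r 0 z)) * (f z * r 0 z) ∂ν =
      ∫ z, (condCov m (Q 0) A (p 0) g z * r 0 z) * (f z * r 0 z) ∂ν := by
  have hint : Integrable (fun z => (A z - p 0 z) * g z) (Q 0 : Measure Z) :=
    (H.memLp_residual_mul M.memLp_score 0).integrable (by norm_num)
  have hcond := integral_mul_condExp H.le hf hint
    (hint.bdd_mul (hf.mono H.le).aestronglyMeasurable (.of_forall hC))
  rw [M.integral_mul_eq, M.integral_mul_eq] at hcond
  calc _ = ∫ z, (f z * r 0 z) * ((A z - p 0 z) * g z * r 0 z) ∂ν := by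
        rw [← integral_const_mul]
        exact integral_congr_ae (.of_forall fun z => by dsimp only; ring)
    _ = _ := by
        rw [← hcond]
        exact integral_congr_ae (.of_forall fun z => mul_comm _ _)

lemma integral_diffQuot_mul_self_le (H : IsCondExpFamily m Q A p) (M : RootModel ν r Q g)
    {ε : ℝ} (hε : ε ≠ 0) :
    ∫ z, (diffQuot p ε z * r ε z) * (diffQuot p ε z * r ε z) ∂ν ≤
      3 ^ 2 * ∫ z, diffQuot r ε z * diffQuot r ε z ∂ν := by
  have hv := H.memLp_diffQuot_mul (M.memLp_root ε) ε
  have hvv := (integrable_mul_of_memLp_two hv hv).div_const 2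
  have hDD := (integrable_mul_of_memLp_two (M.memLp_diffQuot ε) (M.memLp_diffQuot ε)).const_mul 3
  have hint := integrable_mul_of_memLp_two (H.memLp_residual_mul (M.memLp_diffQuot ε) 0)
    (hv.add (H.memLp_diffQuot_mul (M.memLp_root 0) ε))
  have hYoung : ∀ z, ((A z - p 0 z) * diffQuot r ε z) *
      (diffQuot p ε z * r ε z + diffQuot p ε z * r 0 z) ≤
      (diffQuot p ε z * r ε z) * (diffQuot p ε z * r ε z) / 2 +
        3 * (diffQuot r ε z * diffQuot r ε z) := fun z => by
    have hr : r 0 z = r ε z - ε * diffQuot r ε z := by rw [mul_diffQuot r hε]; ring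
    have hB : (A z - p 0 z) ^ 2 ≤ 1 := (sq_le_one_iff_abs_le_one _).2 (H.abs_residual_le 0 z)
    have hΔ : (ε * diffQuot p ε z) ^ 2 ≤ 1 :=
      (sq_le_one_iff_abs_le_one _).2 (H.abs_mul_diffQuot_le ε z)
    have hD := mul_self_nonneg (diffQuot r ε z)
    rw [hr]
    -- With `a = diffQuot p ε * r ε`, `b = A - p 0`, `e = ε * diffQuot p ε`, `D = diffQuot r ε`:
    -- `b D (2 a - e D) ≤ a² / 2 + 2 b² D² + (b² + e²) D² / 2` and `b², e² ≤ 1`.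
    nlinarith [sq_nonneg (diffQuot p ε z * r ε z - 2 * ((A z - p 0 z) * diffQuot r ε z)),
      mul_nonneg (sub_nonneg.2 hB) hD, mul_nonneg (sub_nonneg.2 hΔ) hD,
      sq_nonneg (((A z - p 0 z) + ε * diffQuot p ε z) * diffQuot r ε z)]
  have hmono := integral_mono hint (hvv.add hDD) hYoung
  rw [integral_add' hvv hDD, integral_div, integral_const_mul] at hmono
  have hpol := H.integral_diffQuot_mul M (H.stronglyMeasurable_diffQuot ε) (H.abs_diffQuot_le ε) hε
  have hnn : 0 ≤ ∫ z, diffQuot r ε z * diffQuot r ε z ∂ν :=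
    integral_nonneg fun z => mul_self_nonneg _
  simp only [Pi.add_apply] at hmono
  linarith

lemma l2Bounded_diffQuot (H : IsCondExpFamily m Q A p) (M : RootModel ν r Q g) :
    L2Bounded ν (𝓝[≠] 0) fun ε z => diffQuot p ε z * r ε z := by
  obtain ⟨C, hC⟩ := M.tendsto.l2Bounded
  refine ⟨3 * C, ?_⟩
  filter_upwards [hC, self_mem_nhdsWithin] with ε hCε hε
  have hv := H.memLp_diffQuot_mul (M.memLp_root ε) ε
  refine ⟨hv.1, ?_⟩
  calc eLpNorm (fun z => diffQuot p ε z * r ε z) 2 ν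
      ≤ ENNReal.ofReal √(3 ^ 2 * ∫ z, diffQuot r ε z * diffQuot r ε z ∂ν) := by
        rw [eLpNorm_two_eq_ofReal_sqrt hv]
        exact ENNReal.ofReal_le_ofReal (Real.sqrt_le_sqrt (H.integral_diffQuot_mul_self_le M hε))
    _ = 3 * eLpNorm (diffQuot r ε) 2 ν := by
        rw [Real.sqrt_mul (by norm_num), Real.sqrt_sq (by norm_num),
          ENNReal.ofReal_mul (by norm_num), ← eLpNorm_two_eq_ofReal_sqrt (M.memLp_diffQuot ε)]
        simp
    _ ≤ (3 * C : ℝ≥0) := by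
        rw [ENNReal.coe_mul]
        exact mul_le_mul_right hCε.2 _

lemma l2Bounded_diffQuot_mul_root_zero (H : IsCondExpFamily m Q A p) (M : RootModel ν r Q g) :
    L2Bounded ν (𝓝[≠] 0) fun ε z => diffQuot p ε z * r 0 z := by
  refine ((H.l2Bounded_diffQuot M).add (M.tendsto.l2Bounded.bdd_mul (C := 1)
    (k := fun ε z => -(ε * diffQuot p ε z)) (.of_forall fun ε =>
      ((measurable_diffQuot H.measurable ε).const_mul ε).neg.aestronglyMeasurable)
    (.of_forall fun ε z => (abs_neg _).trans_le (H.abs_mul_diffQuot_le ε z)))).congr ?_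
  filter_upwards [self_mem_nhdsWithin] with ε hε
  funext z
  rw [show r 0 z = r ε z - ε * diffQuot r ε z by rw [mul_diffQuot r hε]; ring]
  ring

lemma l2Tendsto_diffQuot_mul_root_sub (H : IsCondExpFamily m Q A p) (M : RootModel ν r Q g) :
    L2Tendsto ν (𝓝[≠] 0) (fun ε z => diffQuot p ε z * (r ε z - r 0 z)) 0 :=
  M.l2Tendsto_mul_root_sub (measurable_diffQuot H.measurable) (.of_forall H.abs_mul_diffQuot_le)
    (H.l2Bounded_diffQuot_mul_root_zero M)

lemma l2Tendsto_residual_mul_diffQuot (H : IsCondExpFamily m Q A p) (M : RootModel ν r Q g) :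
    L2Tendsto ν (𝓝[≠] 0) (fun ε z => (A z - p 0 z) * diffQuot r ε z)
      fun z => (A z - p 0 z) * (g z / 2 * r 0 z) :=
  M.tendsto.const_bdd_mul (H.measurable_residual 0).aestronglyMeasurable (H.abs_residual_le 0)

lemma tendsto_integral_mul_diffQuot_of_bdd (H : IsCondExpFamily m Q A p)
    (M : RootModel ν r Q g) (hf : StronglyMeasurable[m] f) (hC : ∀ z, |f z| ≤ C) :
    Tendsto (fun ε => ∫ z, (f z * r 0 z) * (diffQuot p ε z * r ε z) ∂ν) (𝓝[≠] 0)
      (𝓝 (∫ z, (f z * r 0 z) * (condCov m (Q 0) A (p 0) g z * r 0 z) ∂ν)) := by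
  have hfm : AEStronglyMeasurable f ν := (hf.mono H.le).aestronglyMeasurable
  have hfr := M.l2Tendsto_root.const_bdd_mul hfm hC
  have hfr₀ : MemLp (fun z => f z * r 0 z) 2 ν := hfr.memLp_lim
  have hswap : Tendsto (fun ε => ∫ z, (f z * (r ε z - r 0 z)) * (diffQuot p ε z * r ε z) ∂ν)
      (𝓝[≠] 0) (𝓝 0) :=
    (M.l2Tendsto_root.sub_lim.bdd_mul (k := fun _ => f) (.of_forall fun _ => hfm)
      (.of_forall fun _ => hC)).tendsto_integral_mul_zero (H.l2Bounded_diffQuot M)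
  have hpol : Tendsto (fun ε => ∫ z, ((A z - p 0 z) * diffQuot r ε z) *
      (f z * r ε z + f z * r 0 z) ∂ν) (𝓝[≠] 0)
      (𝓝 (∫ z, ((A z - p 0 z) * (g z / 2 * r 0 z)) * (f z * r 0 z + f z * r 0 z) ∂ν)) := by
    have hsum := hfr.add (L2Tendsto.const hfr₀)
    refine (H.l2Tendsto_residual_mul_diffQuot M).tendsto_integral_mul hsum.l2Bounded ?_
    simpa only [mul_comm] using hsum.tendsto_integral_mul (L2Bounded.const
      (H.memLp_residual_mul M.tendsto.memLp_lim 0)) tendsto_const_nhds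
  have hlim : ∫ z, ((A z - p 0 z) * (g z / 2 * r 0 z)) * (f z * r 0 z + f z * r 0 z) ∂ν =
      ∫ z, (f z * r 0 z) * (condCov m (Q 0) A (p 0) g z * r 0 z) ∂ν := by
    simp only [← two_mul, mul_left_comm _ (2 : ℝ), integral_const_mul,
      H.integral_condCov_mul M hf hC, mul_comm (f _ * r 0 _)]
  rw [← hlim, ← sub_zero (∫ z, _ ∂ν)]
  refine (hpol.sub hswap).congr' ?_
  filter_upwards [self_mem_nhdsWithin] with ε hε
  have hv := H.memLp_diffQuot_mul (M.memLp_root ε) ε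
  have hdiff : MemLp (fun z => f z * (r ε z - r 0 z)) 2 ν :=
    memLp_bdd_mul ((M.memLp_root ε).sub (M.memLp_root 0)) hfm hC
  rw [← H.integral_diffQuot_mul M hf hC hε, ← integral_sub
    (integrable_mul_of_memLp_two hv (memLp_bdd_mul (M.memLp_root ε) hfm hC))
    (integrable_mul_of_memLp_two hdiff hv)]
  exact integral_congr_ae (.of_forall fun z => by dsimp only; ring)

lemma tendsto_integral_condCov_mul_diffQuot (H : IsCondExpFamily m Q A p)
    (M : RootModel ν r Q g) :
    Tendsto (fun ε => ∫ z, (condCov m (Q 0) A (p 0) g z * r 0 z) * (diffQuot p ε z * r ε z) ∂ν)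
      (𝓝[≠] 0) (𝓝 (∫ z, (condCov m (Q 0) A (p 0) g z * r 0 z) *
        (condCov m (Q 0) A (p 0) g z * r 0 z) ∂ν)) := by
  set c : Z → ℝ := condCov m (Q 0) A (p 0) g
  have hc : StronglyMeasurable[m] c := stronglyMeasurable_condCov
  have htrunc := L2Tendsto.indicator_abs_le (H.memLp_condCov_mul_root M)
    (hc.mono H.le).measurable
  refine htrunc.tendsto_integral_lim_mul (H.l2Bounded_diffQuot M) (H.memLp_condCov_mul_root M)
    fun n => ?_
  have hset : MeasurableSet[m] {z | |c z| ≤ n} :=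
    measurableSet_le (measurable_norm.comp hc.measurable) measurable_const
  simpa only [Set.indicator_mul_left] using H.tendsto_integral_mul_diffQuot_of_bdd M
    (hc.indicator hset) (C := n) fun z => by by_cases hz : |c z| ≤ n <;> simp [hz]

lemma tendsto_integral_residual_mul_diffQuot (H : IsCondExpFamily m Q A p)
    (M : RootModel ν r Q g) :
    Tendsto (fun ε => ∫ z, ((A z - p 0 z) * (g z / 2 * r 0 z)) *
        (diffQuot p ε z * r ε z + diffQuot p ε z * r 0 z) ∂ν) (𝓝[≠] 0)
      (𝓝 (∫ z, (condCov m (Q 0) A (p 0) g z * r 0 z) *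
        (condCov m (Q 0) A (p 0) g z * r 0 z) ∂ν)) := by
  set c : Z → ℝ := fun z => condCov m (Q 0) A (p 0) g z * r 0 z
  set s : Z → ℝ := fun z => (A z - p 0 z) * (g z / 2 * r 0 z)
  have hc : MemLp c 2 ν := H.memLp_condCov_mul_root M
  have hs : MemLp s 2 ν := H.memLp_residual_mul M.tendsto.memLp_lim 0
  have hcorr := (H.l2Tendsto_diffQuot_mul_root_sub M).tendsto_integral_mul_zero
    (v := fun _ z => s z - c z) (L2Bounded.const (hs.sub hc))
  rw [← add_zero (∫ z, _ ∂ν)]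
  refine ((H.tendsto_integral_condCov_mul_diffQuot M).add hcorr).congr fun ε => ?_
  have hv := H.memLp_diffQuot_mul (M.memLp_root ε) ε
  have hw := H.memLp_diffQuot_mul (M.memLp_root 0) ε
  have he : MemLp (fun z => diffQuot p ε z * (r ε z - r 0 z)) 2 ν :=
    H.memLp_diffQuot_mul ((M.memLp_root ε).sub (M.memLp_root 0)) ε
  calc _ = ∫ z, c z * (diffQuot p ε z * r 0 z) ∂ν +
        ∫ z, (diffQuot p ε z * (r ε z - r 0 z)) * s z ∂ν := by
        rw [← integral_add (integrable_mul_of_memLp_two hc hv)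
            (integrable_mul_of_memLp_two he (v := fun z => s z - c z) (hs.sub hc)),
          ← integral_add (integrable_mul_of_memLp_two hc hw) (integrable_mul_of_memLp_two he hs)]
        exact integral_congr_ae (.of_forall fun z => by dsimp only; ring)
    _ = 2 * ∫ z, s z * (diffQuot p ε z * r 0 z) ∂ν +
        ∫ z, (diffQuot p ε z * (r ε z - r 0 z)) * s z ∂ν := by
        rw [← H.integral_condCov_mul M (H.stronglyMeasurable_diffQuot ε) (H.abs_diffQuot_le ε)]
    _ = _ := by
        rw [← integral_const_mul, ← integral_add ((integrable_mul_of_memLp_two hs hw).const_mul 2)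
          (integrable_mul_of_memLp_two he hs)]
        exact integral_congr_ae (.of_forall fun z => by dsimp only; ring)

lemma l2Tendsto_diffQuot (H : IsCondExpFamily m Q A p) (M : RootModel ν r Q g) :
    L2Tendsto ν (𝓝[≠] 0) (fun ε z => diffQuot p ε z * r ε z)
      fun z => condCov m (Q 0) A (p 0) g z * r 0 z := by
  refine .of_tendsto_integral (H.l2Bounded_diffQuot M).memLp (H.memLp_condCov_mul_root M) ?_
    (H.tendsto_integral_condCov_mul_diffQuot M)
  refine ((H.l2Tendsto_residual_mul_diffQuot M).tendsto_integral_mul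
    ((H.l2Bounded_diffQuot M).add (H.l2Bounded_diffQuot_mul_root_zero M))
    (H.tendsto_integral_residual_mul_diffQuot M)).congr' ?_
  filter_upwards [self_mem_nhdsWithin] with ε hε
  exact (H.integral_diffQuot_mul M (H.stronglyMeasurable_diffQuot ε) (H.abs_diffQuot_le ε) hε).symm

end IsCondExpFamily

end CondExp

section HasL2Deriv

variable {Z : Type*} {m : MeasurableSpace Z} [mZ : MeasurableSpace Z] {ν : Measure Z}
  {r : ℝ → Z → ℝ} {Q : ℝ → ProbabilityMeasure Z} {g : Z → ℝ} {k l : ℝ → Z → ℝ} {k' l' : Z → ℝ}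

/-- A uniformly bounded family of functions `k ε` which is differentiable at `0` with derivative
`k'` in `L²`, along a model with root densities `r`. -/
structure HasL2Deriv (ν : Measure Z) (r k : ℝ → Z → ℝ) (k' : Z → ℝ) : Prop where
  measurable : ∀ ε, Measurable (k ε)
  bounded : ∃ C, ∀ ε z, |k ε z| ≤ C
  measurable_deriv : Measurable k'
  tendsto : L2Tendsto ν (𝓝[≠] 0) (fun ε z => diffQuot k ε z * r ε z) fun z => k' z * r 0 z

lemma IsCondExpFamily.hasL2Deriv {A : Z → ℝ} {p : ℝ → Z → ℝ}
    (H : IsCondExpFamily m Q A p) (M : RootModel ν r Q g) :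
    HasL2Deriv ν r p (condCov m (Q 0) A (p 0) g) where
  measurable := H.measurable
  bounded := ⟨1, fun ε z => abs_le.2 ⟨by linarith [(H.mem ε z).1], (H.mem ε z).2⟩⟩
  measurable_deriv := (stronglyMeasurable_condCov.mono H.le).measurable
  tendsto := H.l2Tendsto_diffQuot M

namespace HasL2Deriv

lemma const {f : Z → ℝ} (hf : Measurable f) {C : ℝ} (hC : ∀ z, |f z| ≤ C) :
    HasL2Deriv ν r (fun _ => f) fun _ => 0 where
  measurable _ := hf
  bounded := ⟨C, fun _ => hC⟩
  measurable_deriv := measurable_const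
  tendsto := by simpa [diffQuot, Pi.zero_def] using L2Tendsto.const (ν := ν) (u₀ := 0) MemLp.zero

lemma congr_deriv (hk : HasL2Deriv ν r k k') (h : ∀ z, k' z = l' z) : HasL2Deriv ν r k l' :=
  funext h ▸ hk

lemma affine (hk : HasL2Deriv ν r k k') (a b : ℝ) :
    HasL2Deriv ν r (fun ε z => a * k ε z + b) fun z => a * k' z where
  measurable ε := ((hk.measurable ε).const_mul a).add_const b
  bounded := by
    obtain ⟨C, hC⟩ := hk.bounded
    refine ⟨|a| * C + |b|, fun ε z => (abs_add_le _ _).trans ?_⟩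
    rw [abs_mul]
    gcongr
    exact hC ε z
  measurable_deriv := hk.measurable_deriv.const_mul a
  tendsto := by
    simp only [mul_assoc]
    refine (hk.tendsto.const_bdd_mul (f := fun _ => a) (C := |a|) aestronglyMeasurable_const
      fun _ => le_rfl).congr (.of_forall fun ε => funext fun z => ?_)
    simp only [diffQuot]
    ring

lemma l2Tendsto_sub_mul_root (hk : HasL2Deriv ν r k k') :
    L2Tendsto ν (𝓝[≠] 0) (fun ε z => (k ε z - k 0 z) * r ε z) 0 := by
  have hid : Tendsto (fun ε : ℝ => ε) (𝓝[≠] 0) (𝓝 0) := tendsto_id.mono_left nhdsWithin_le_nhds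
  refine (hk.tendsto.l2Bounded.l2Tendsto_zero_of_tendsto_mul hid).congr ?_
  filter_upwards [self_mem_nhdsWithin] with ε hε
  exact funext fun z => by rw [← mul_assoc, mul_diffQuot k hε]

lemma l2Tendsto_sub_mul (hk : HasL2Deriv ν r k k') (M : RootModel ν r Q g) {u : ℝ → Z → ℝ}
    {f : Z → ℝ} (hu : L2Tendsto ν (𝓝[≠] 0) u fun z => f z * r 0 z) (hf : Measurable f) :
    L2Tendsto ν (𝓝[≠] 0) (fun ε z => (k ε z - k 0 z) * u ε z) 0 := by
  obtain ⟨C, hC⟩ := hk.bounded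
  have hmeas : ∀ ε, Measurable fun z => k ε z - k 0 z := fun ε =>
    (hk.measurable ε).sub (hk.measurable 0)
  have hbound : ∀ ε z, |k ε z - k 0 z| ≤ C + C := fun ε z =>
    (abs_sub _ _).trans (add_le_add (hC ε z) (hC 0 z))
  have hroot : L2Tendsto ν (𝓝[≠] 0) (fun ε z => (k ε z - k 0 z) * r 0 z) 0 := by
    have hdiff := M.l2Tendsto_root.sub_lim.bdd_mul (C := C + C) (k := fun ε z => -(k ε z - k 0 z))
      (.of_forall fun ε => (hmeas ε).neg.aestronglyMeasurable)
      (.of_forall fun ε z => (abs_neg _).trans_le (hbound ε z))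
    have hsum := hk.l2Tendsto_sub_mul_root.add hdiff
    simp only [Pi.zero_apply, add_zero] at hsum
    exact hsum.congr (.of_forall fun ε => funext fun z => by ring)
  exact hu.bdd_mul_of_mul_tendsto hroot (.of_forall fun ε => (hmeas ε).aestronglyMeasurable)
    (.of_forall hbound) hf

lemma mul (hk : HasL2Deriv ν r k k') (hl : HasL2Deriv ν r l l') (M : RootModel ν r Q g) :
    HasL2Deriv ν r (fun ε z => k ε z * l ε z) fun z => k' z * l 0 z + k 0 z * l' z := by
  obtain ⟨C, hC⟩ := hk.bounded
  obtain ⟨D, hD⟩ := hl.bounded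
  refine ⟨fun ε => (hk.measurable ε).mul (hl.measurable ε), ⟨C * D, fun ε z => ?_⟩,
    (hk.measurable_deriv.mul (hl.measurable 0)).add ((hk.measurable 0).mul hl.measurable_deriv), ?_⟩
  · rw [abs_mul]
    exact mul_le_mul (hC ε z) (hD ε z) (abs_nonneg _) ((abs_nonneg _).trans (hC ε z))
  · have hlead := (hk.tendsto.const_bdd_mul (hl.measurable 0).aestronglyMeasurable (hD 0)).add
      (hl.tendsto.const_bdd_mul (hk.measurable 0).aestronglyMeasurable (hC 0))
    have hsum := hlead.add (hk.l2Tendsto_sub_mul M hl.tendsto hl.measurable_deriv)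
    rw [show (fun z => (k' z * l 0 z + k 0 z * l' z) * r 0 z) =
      fun z => l 0 z * (k' z * r 0 z) + k 0 z * (l' z * r 0 z) + (0 : Z → ℝ) z from
        funext fun z => by simp only [Pi.zero_apply]; ring]
    refine hsum.congr (.of_forall fun ε => funext fun z => ?_)
    simp only [diffQuot]
    ring

lemma inv (hk : HasL2Deriv ν r k k') (M : RootModel ν r Q g) {c : ℝ} (hc : 0 < c)
    (hkc : ∀ ε z, c ≤ k ε z) :
    HasL2Deriv ν r (fun ε z => (k ε z)⁻¹) fun z => -k' z / k 0 z ^ 2 := by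
  have hpos : ∀ ε z, 0 < k ε z := fun ε z => hc.trans_le (hkc ε z)
  have hinv : ∀ ε z, |(k ε z)⁻¹| ≤ c⁻¹ := fun ε z => by
    rw [abs_of_pos (inv_pos.2 (hpos ε z))]
    exact inv_anti₀ hc (hkc ε z)
  have hsq : ∀ ε z, |((k ε z)⁻¹) ^ 2| ≤ c⁻¹ ^ 2 := fun ε z => by
    rw [abs_pow]
    exact pow_le_pow_left₀ (abs_nonneg _) (hinv ε z) 2
  have hcub : ∀ ε z, |(k 0 z)⁻¹ ^ 2 * (k ε z)⁻¹| ≤ c⁻¹ ^ 2 * c⁻¹ := fun ε z => by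
    rw [abs_mul]
    exact mul_le_mul (hsq 0 z) (hinv ε z) (abs_nonneg _) (by positivity)
  have hmeas := fun ε => (hk.measurable ε).inv
  refine ⟨hmeas, ⟨c⁻¹, hinv⟩, hk.measurable_deriv.neg.div ((hk.measurable 0).pow_const 2), ?_⟩
  have hlead := hk.tendsto.const_bdd_mul (f := fun z => -((k 0 z)⁻¹) ^ 2) (C := c⁻¹ ^ 2)
    ((hmeas 0).pow_const 2).neg.aestronglyMeasurable fun z => (abs_neg _).trans_le (hsq 0 z)
  have hcorr := (hk.l2Tendsto_sub_mul M hk.tendsto hk.measurable_deriv).bdd_mul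
    (.of_forall fun ε => (((hmeas 0).pow_const 2).mul (hmeas ε)).aestronglyMeasurable)
    (.of_forall hcub)
  rw [show (fun z => -k' z / k 0 z ^ 2 * r 0 z) =
    fun z => -((k 0 z)⁻¹) ^ 2 * (k' z * r 0 z) + (0 : Z → ℝ) z from
      funext fun z => by simp only [Pi.zero_apply]; ring]
  refine (hlead.add hcorr).congr (.of_forall fun ε => funext fun z => ?_)
  have := (hpos ε z).ne'
  have := (hpos 0 z).ne'
  simp only [diffQuot, Pi.mul_apply, Pi.inv_apply]
  field_simp
  ring

lemma prod (M : RootModel ν r Q g) {ι : Type*} (s : Finset ι) {k : ι → ℝ → Z → ℝ}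
    {k' : ι → Z → ℝ} (h : ∀ i ∈ s, HasL2Deriv ν r (k i) fun z => k i 0 z * k' i z) :
    HasL2Deriv ν r (fun ε z => ∏ i ∈ s, k i ε z)
      fun z => (∏ i ∈ s, k i 0 z) * ∑ i ∈ s, k' i z := by
  classical
  induction s using Finset.induction_on with
  | empty =>
    simpa only [Finset.prod_empty, Finset.sum_empty, mul_zero] using
      const (C := 1) measurable_const (by simp)
  | insert i s hi ih =>
    simp only [Finset.prod_insert hi, Finset.sum_insert hi]
    exact ((h i (s.mem_insert_self i)).mul (ih fun j hj => h j (Finset.mem_insert_of_mem hj))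
      M).congr_deriv fun z => by ring

end HasL2Deriv

namespace RootModel

variable {Y : Z → ℝ}

lemma l2Bounded_mul_root (M : RootModel ν r Q g) (hY : Measurable Y) {C : ℝ≥0}
    (hC : ∀ᶠ ε in 𝓝 0, ∫⁻ z, ‖Y z‖ₑ ^ 2 ∂(Q ε : Measure Z) ≤ C) :
    L2Bounded ν (𝓝 0) fun ε z => Y z * r ε z := by
  refine ⟨C ^ (1 / 2 : ℝ), hC.mono fun ε hε => ⟨(hY.mul (M.measurable_root ε)).aestronglyMeasurable,
    ?_⟩⟩
  rw [← eLpNorm_withDensity_enorm_sq hY (M.measurable_root ε), ← M.law,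
    eLpNorm_eq_lintegral_rpow_enorm_toReal two_ne_zero ENNReal.ofNat_ne_top,
    ENNReal.coe_rpow_of_nonneg _ (by norm_num)]
  simp only [ENNReal.toReal_ofNat, ENNReal.rpow_ofNat]
  gcongr

/-- Weak convergence in `L²(ν)` of `Y * r ε`: it holds against the truncations of `f` to the sets
`|Y| ≤ n`, where `r ε → r 0` is enough, and these approximate `f`. -/
lemma tendsto_integral_mul_root (M : RootModel ν r Q g) (hY : Measurable Y)
    (hYr : L2Bounded ν (𝓝 0) fun ε z => Y z * r ε z) {f : Z → ℝ} (hf : MemLp f 2 ν) :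
    Tendsto (fun ε => ∫ z, f z * (Y z * r ε z) ∂ν) (𝓝[≠] 0)
      (𝓝 (∫ z, f z * (Y z * r 0 z) ∂ν)) := by
  refine (L2Tendsto.indicator_abs_le hf hY).tendsto_integral_lim_mul
    (hYr.comp_tendsto (φ := id) nhdsWithin_le_nhds) hYr.memLp.self_of_nhds fun n => ?_
  have hset : MeasurableSet {z | |Y z| ≤ n} := measurableSet_le hY.abs measurable_const
  have htrunc : MemLp (fun z => {z | |Y z| ≤ n}.indicator Y z * f z) 2 ν :=
    memLp_bdd_mul (C := n) hf (hY.indicator hset).aestronglyMeasurable fun z => by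
      by_cases hz : |Y z| ≤ n <;> simp [hz]
  have hswap : ∀ ε, ∫ z, r ε z * ({z | |Y z| ≤ n}.indicator Y z * f z) ∂ν =
      ∫ z, {z | |Y z| ≤ n}.indicator f z * (Y z * r ε z) ∂ν := fun ε =>
    integral_congr_ae (.of_forall fun z => by
      by_cases hz : z ∈ {z | |Y z| ≤ n}
      · simp only [Set.indicator_of_mem hz]
        ring
      · simp only [Set.indicator_of_notMem hz, zero_mul, mul_zero])
  simpa only [hswap] using
    M.l2Tendsto_root.tendsto_integral_mul (L2Bounded.const htrunc) tendsto_const_nhds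

lemma tendsto_integral_diffQuot_mul (M : RootModel ν r Q g) (hY : Measurable Y)
    (hYr : L2Bounded ν (𝓝 0) fun ε z => Y z * r ε z) :
    Tendsto (fun ε => ∫ z, diffQuot r ε z * (Y z * r ε z + Y z * r 0 z) ∂ν) (𝓝[≠] 0)
      (𝓝 (∫ z, Y z * g z ∂(Q 0 : Measure Z))) := by
  have hY₀ : MemLp (fun z => Y z * r 0 z) 2 ν := hYr.memLp.self_of_nhds
  have hYr' : L2Bounded ν (𝓝[≠] 0) fun ε z => Y z * r ε z :=
    hYr.comp_tendsto (φ := id) nhdsWithin_le_nhds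
  have hg := M.tendsto.memLp_lim
  refine M.tendsto.tendsto_integral_mul (hYr'.add (.const hY₀)) ?_
  have hlim : ∫ z, Y z * g z ∂(Q 0 : Measure Z) = ∫ z, (g z / 2 * r 0 z) * (Y z * r 0 z) ∂ν +
      ∫ z, (g z / 2 * r 0 z) * (Y z * r 0 z) ∂ν := by
    rw [M.integral_mul_eq, ← integral_add (integrable_mul_of_memLp_two hg hY₀)
      (integrable_mul_of_memLp_two hg hY₀)]
    exact integral_congr_ae (.of_forall fun z => by dsimp only; ring)
  rw [hlim]
  refine ((M.tendsto_integral_mul_root hY hYr hg).add_const _).congr' ?_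
  filter_upwards [hYr'.memLp] with ε hε
  rw [← integral_add (integrable_mul_of_memLp_two hg hε) (integrable_mul_of_memLp_two hg hY₀)]
  exact integral_congr_ae (.of_forall fun z => by dsimp only; ring)

theorem hasDerivAt_integral_mul (M : RootModel ν r Q g) (hk : HasL2Deriv ν r k k')
    (hY : Measurable Y) (hYr : L2Bounded ν (𝓝 0) fun ε z => Y z * r ε z) :
    HasDerivAt (fun ε => ∫ z, k ε z * Y z ∂(Q ε : Measure Z))
      (∫ z, k' z * Y z ∂(Q 0 : Measure Z) + ∫ z, k 0 z * Y z * g z ∂(Q 0 : Measure Z)) 0 := by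
  obtain ⟨C, hC⟩ := hk.bounded
  have hYr' : L2Bounded ν (𝓝[≠] 0) fun ε z => Y z * r ε z :=
    hYr.comp_tendsto (φ := id) nhdsWithin_le_nhds
  have hkY : L2Bounded ν (𝓝 0) fun ε z => k 0 z * Y z * r ε z := by
    simpa only [mul_assoc] using hYr.bdd_mul (k := fun _ => k 0)
      (.of_forall fun _ => (hk.measurable 0).aestronglyMeasurable) (.of_forall fun _ => hC 0)
  have hkY' : L2Bounded ν (𝓝[≠] 0) fun ε z => k 0 z * Y z * r ε z :=
    hkY.comp_tendsto (φ := id) nhdsWithin_le_nhds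
  have hkr : ∀ ε, MemLp (fun z => k ε z * r ε z) 2 ν := fun ε =>
    memLp_bdd_mul (M.memLp_root ε) (hk.measurable ε).aestronglyMeasurable (hC ε)
  rw [hasDerivAt_iff_tendsto_slope, M.integral_mul_eq]
  refine ((hk.tendsto.tendsto_integral_mul hYr' (M.tendsto_integral_mul_root hY hYr
    hk.tendsto.memLp_lim)).add (M.tendsto_integral_diffQuot_mul (Y := fun z => k 0 z * Y z)
    ((hk.measurable 0).mul hY) hkY)).congr' ?_
  filter_upwards [hYr'.memLp, hkY'.memLp, hk.tendsto.l2Bounded.memLp] with ε hYε hkYε hkε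
  have hsum : MemLp (fun z => k 0 z * Y z * r ε z + k 0 z * Y z * r 0 z) 2 ν :=
    hkYε.add hkY.memLp.self_of_nhds
  rw [slope_def_field, M.integral_mul_eq, M.integral_mul_eq,
    ← integral_sub (integrable_mul_of_memLp_two (hkr ε) hYε)
      (integrable_mul_of_memLp_two (hkr 0) hYr.memLp.self_of_nhds),
    ← integral_add (integrable_mul_of_memLp_two hkε hYε)
      (integrable_mul_of_memLp_two (M.memLp_diffQuot ε) hsum), sub_zero, ← integral_div]
  refine integral_congr_ae (.of_forall fun z => ?_)
  simp only [diffQuot]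
  ring

lemma integral_score (M : RootModel ν r Q g) : ∫ z, g z ∂(Q 0 : Measure Z) = 0 := by
  have hr : L2Bounded ν (𝓝 0) fun ε z => 1 * r ε z :=
    M.l2Bounded_mul_root (C := 1) measurable_const (.of_forall fun ε => by simp)
  have hderiv := M.hasDerivAt_integral_mul (HasL2Deriv.const (f := fun _ => 1) (C := 1)
    measurable_const (by simp)) measurable_const hr
  simp only [mul_one, integral_const, probReal_univ, smul_eq_mul, mul_zero, one_mul,
    zero_add] at hderiv
  exact hderiv.unique (hasDerivAt_const _ _)

end RootModel

end HasL2Deriv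

section Tangent

variable {Z : Type*} [MeasurableSpace Z]

lemma integral_mul_eq_zero_of_mem_closure_span {μ : Measure Z} {G : Set (Z → ℝ)} {u φ : Z → ℝ}
    (hG : ∀ g ∈ G, MemLp g 2 μ) (hu : MemLp u 2 μ) (hφ : MemLp φ 2 μ)
    (horth : ∀ g ∈ G, ∫ z, u z * g z ∂μ = 0)
    (hspan : ∀ η : ℝ≥0∞, 0 < η → ∃ h ∈ Submodule.span ℝ G, eLpNorm (fun z => φ z - h z) 2 μ < η) :
    ∫ z, u z * φ z ∂μ = 0 := by
  have horth_span : ∀ h ∈ Submodule.span ℝ G, MemLp h 2 μ ∧ ∫ z, u z * h z ∂μ = 0 := by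
    intro h hh
    induction hh using Submodule.span_induction with
    | mem g hg => exact ⟨hG g hg, horth g hg⟩
    | zero => simp
    | add x y _ _ hx hy =>
      refine ⟨hx.1.add hy.1, ?_⟩
      simp only [Pi.add_apply, mul_add]
      rw [integral_add (integrable_mul_of_memLp_two hu hx.1) (integrable_mul_of_memLp_two hu hy.1),
        hx.2, hy.2, add_zero]
    | smul c x _ hx =>
      refine ⟨hx.1.const_smul c, ?_⟩
      simp only [Pi.smul_apply, smul_eq_mul, mul_left_comm _ c, integral_const_mul, hx.2, mul_zero]
  have hbound : ∀ η : ℝ≥0∞, 0 < η → ‖∫ z, u z * φ z ∂μ‖ₑ ≤ eLpNorm u 2 μ * η := by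
    intro η hη
    obtain ⟨h, hh, hclose⟩ := hspan η hη
    obtain ⟨hh2, hh0⟩ := horth_span h hh
    have hsub : ∫ z, u z * φ z ∂μ = ∫ z, u z * (φ z - h z) ∂μ := by
      simp only [mul_sub]
      rw [integral_sub (integrable_mul_of_memLp_two hu hφ) (integrable_mul_of_memLp_two hu hh2),
        hh0, sub_zero]
    rw [hsub]
    exact (enorm_integral_mul_le hu.1 (hφ.sub hh2).1).trans (by gcongr; exact hclose.le)
  rw [← enorm_eq_zero, ← le_zero_iff]
  have hlim : Tendsto (fun η : ℝ≥0∞ => eLpNorm u 2 μ * η) (𝓝[>] 0) (𝓝 0) := by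
    simpa using (ENNReal.Tendsto.const_mul (tendsto_id (x := 𝓝 (0 : ℝ≥0∞)))
      (.inr hu.2.ne)).mono_left nhdsWithin_le_nhds
  exact ge_of_tendsto hlim (eventually_nhdsWithin_of_forall hbound)

lemma IsEIF.ae_eq {S : (ℝ → ProbabilityMeasure Z) → (Z → ℝ) → Prop}
    {Ψ : ProbabilityMeasure Z → ℝ} {P : ProbabilityMeasure Z} {φ₁ φ₂ : Z → ℝ}
    (hS : ∀ Q g, S Q g → MemLp g 2 (P : Measure Z)) (h₁ : IsEIF S Ψ P φ₁)
    (h₂ : IsEIF S Ψ P φ₂) : φ₁ =ᵐ[(P : Measure Z)] φ₂ := by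
  have hG : ∀ g ∈ {g : Z → ℝ | ∃ Q, S Q g}, MemLp g 2 (P : Measure Z) := fun g ⟨Q, hQ⟩ => hS Q g hQ
  have hdiff : MemLp (fun z => φ₁ z - φ₂ z) 2 (P : Measure Z) := h₁.memLp.sub h₂.memLp
  have horth : ∀ g ∈ {g : Z → ℝ | ∃ Q, S Q g}, ∫ z, (φ₁ z - φ₂ z) * g z ∂(P : Measure Z) = 0 := by
    rintro g ⟨Q, hQ⟩
    have hg := hS Q g hQ
    simp only [sub_mul]
    rw [integral_sub (integrable_mul_of_memLp_two h₁.memLp hg)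
      (integrable_mul_of_memLp_two h₂.memLp hg), sub_eq_zero]
    exact (h₁.pathwise Q g hQ).unique (h₂.pathwise Q g hQ)
  have hsq : ∫ z, (φ₁ z - φ₂ z) ^ 2 ∂(P : Measure Z) = 0 := by
    simp only [sq, mul_sub (_ - _)]
    rw [integral_sub (integrable_mul_of_memLp_two hdiff h₁.memLp)
        (integrable_mul_of_memLp_two hdiff h₂.memLp),
      integral_mul_eq_zero_of_mem_closure_span hG hdiff h₁.memLp horth h₁.tangent,
      integral_mul_eq_zero_of_mem_closure_span hG hdiff h₂.memLp horth h₂.tangent, sub_zero]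
  filter_upwards [(integral_eq_zero_iff_of_nonneg (fun z => sq_nonneg _)
    hdiff.integrable_sq).1 hsq] with z hz
  exact sub_eq_zero.1 (pow_eq_zero_iff two_ne_zero |>.1 hz)

section Tilt

variable {P : ProbabilityMeasure Z} {h : Z → ℝ} {K ε : ℝ}

lemma eventually_abs_mul_le_one (K : ℝ) : ∀ᶠ ε : ℝ in 𝓝 0, |ε| * K ≤ 1 :=
  ((continuous_abs.mul continuous_const).tendsto' 0 0 (by simp)).eventually_le_const one_pos

lemma one_add_mul_mem_Icc {x : ℝ} (hx : |x| ≤ K) (hε : |ε| * K ≤ 1) :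
    1 + ε * x ∈ Set.Icc (0 : ℝ) 2 := by
  have : |ε * x| ≤ 1 := abs_mul ε x ▸ (mul_le_mul_of_nonneg_left hx (abs_nonneg ε)).trans hε
  constructor <;> linarith [abs_le.1 this]

lemma abs_sqrt_one_add_sub_le {x : ℝ} (hx : -1 ≤ x) : |√(1 + x) - 1 - x / 2| ≤ x ^ 2 / 2 := by
  have hsq : √(1 + x) ^ 2 = 1 + x := Real.sq_sqrt (by linarith)
  have hx_eq : x = (√(1 + x) - 1) * (√(1 + x) + 1) := by linear_combination -hsq
  calc |√(1 + x) - 1 - x / 2| = |-((√(1 + x) - 1) ^ 2 / 2)| := by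
        congr 1
        linear_combination hsq / 2
    _ = (√(1 + x) - 1) ^ 2 * 1 / 2 := by rw [abs_neg, abs_of_nonneg (by positivity), mul_one]
    _ ≤ (√(1 + x) - 1) ^ 2 * (√(1 + x) + 1) ^ 2 / 2 := by
        gcongr
        nlinarith [Real.sqrt_nonneg (1 + x)]
    _ = x ^ 2 / 2 := by rw [← mul_pow, ← hx_eq]

lemma abs_sqrt_one_add_mul_quotient_sub_le {x : ℝ} (hx : |x| ≤ K) (hε : |ε| * K ≤ 1)
    (hε0 : ε ≠ 0) : |(√(1 + ε * x) - 1) / ε - x / 2| ≤ |ε| * (K ^ 2 / 2) := by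
  have hsplit : (√(1 + ε * x) - 1) / ε - x / 2 = (√(1 + ε * x) - 1 - ε * x / 2) / ε := by
    field_simp
  rw [hsplit, abs_div, div_le_iff₀ (abs_pos.2 hε0)]
  calc |√(1 + ε * x) - 1 - ε * x / 2| ≤ (ε * x) ^ 2 / 2 :=
        abs_sqrt_one_add_sub_le (by linarith [(one_add_mul_mem_Icc hx hε).1])
    _ = |ε| ^ 2 * |x| ^ 2 / 2 := by rw [mul_pow, sq_abs, sq_abs]
    _ ≤ |ε| ^ 2 * K ^ 2 / 2 := by gcongr
    _ = |ε| * (K ^ 2 / 2) * |ε| := by ring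

open Classical in
/-- The one-parameter model with densities `1 + ε h` with respect to `P`. It is used for bounded
mean-zero `h` and small `ε`; the value is `P` when `1 + ε h` is not a probability density. -/
noncomputable def tilt (P : ProbabilityMeasure Z) (h : Z → ℝ) (ε : ℝ) : ProbabilityMeasure Z :=
  if H : IsProbabilityMeasure ((P : Measure Z).withDensity fun z => ENNReal.ofReal (1 + ε * h z))
  then ⟨_, H⟩ else P

lemma tilt_absolutelyContinuous (P : ProbabilityMeasure Z) (h : Z → ℝ) (ε : ℝ) :
    (tilt P h ε : Measure Z) ≪ P := by
  by_cases H : IsProbabilityMeasure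
    ((P : Measure Z).withDensity fun z => ENNReal.ofReal (1 + ε * h z))
  · simpa [tilt, H] using withDensity_absolutelyContinuous _ _
  · simpa [tilt, H] using Measure.AbsolutelyContinuous.refl _

lemma coe_tilt (hm : Measurable h) (hK : ∀ z, |h z| ≤ K) (h0 : ∫ z, h z ∂(P : Measure Z) = 0)
    (hε : |ε| * K ≤ 1) :
    (tilt P h ε : Measure Z) =
      (P : Measure Z).withDensity fun z => ENNReal.ofReal (1 + ε * h z) := by
  have hi : Integrable h (P : Measure Z) := .of_bound hm.aestronglyMeasurable K (.of_forall hK)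
  have hint : Integrable (fun z => 1 + ε * h z) (P : Measure Z) :=
    (integrable_const 1).add (hi.const_mul ε)
  have hmass : ∫ z, (1 + ε * h z) ∂(P : Measure Z) = 1 := by
    rw [integral_add (integrable_const 1) (hi.const_mul ε), integral_const_mul, h0]
    simp
  have hprob : IsProbabilityMeasure
      ((P : Measure Z).withDensity fun z => ENNReal.ofReal (1 + ε * h z)) := by
    refine ⟨?_⟩
    rw [withDensity_apply _ .univ, Measure.restrict_univ,
      ← ofReal_integral_eq_lintegral_ofReal hint
      (.of_forall fun z => (one_add_mul_mem_Icc (hK z) hε).1), hmass, ENNReal.ofReal_one]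
  simp [tilt, hprob]

lemma density_self (P : ProbabilityMeasure Z) :
    density P P =ᵐ[(P : Measure Z)] fun _ => 1 := by
  filter_upwards [Measure.rnDeriv_self (P : Measure Z)] with z hz
  simp only [density, hz, ENNReal.toReal_one]

lemma density_tilt (hm : Measurable h) (hK : ∀ z, |h z| ≤ K)
    (h0 : ∫ z, h z ∂(P : Measure Z) = 0) (hε : |ε| * K ≤ 1) :
    density (tilt P h ε) P =ᵐ[(P : Measure Z)] fun z => 1 + ε * h z := by
  have hmd : Measurable fun z => ENNReal.ofReal (1 + ε * h z) := by fun_prop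
  filter_upwards [Measure.rnDeriv_withDensity (P : Measure Z) hmd] with z hz
  rw [density, coe_tilt hm hK h0 hε, hz,
    ENNReal.toReal_ofReal (one_add_mul_mem_Icc (hK z) hε).1]

lemma isSubmodel_tilt (hm : Measurable h) (hK : ∀ z, |h z| ≤ K)
    (h0 : ∫ z, h z ∂(P : Measure Z) = 0) : IsSubmodel P (tilt P h) h where
  base := Subtype.ext ((coe_tilt hm hK h0 (ε := 0) (by simp)).trans (by simp))
  score_memLp := .of_bound hm.aestronglyMeasurable K (.of_forall hK)
  qmd := by
    refine ⟨P, inferInstance, tilt_absolutelyContinuous P h, ?_⟩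
    have hlim : Tendsto (fun ε : ℝ => ENNReal.ofReal (|ε| * (K ^ 2 / 2))) (𝓝[≠] 0) (𝓝 0) :=
      ((ENNReal.continuous_ofReal.comp (continuous_abs.mul continuous_const)).tendsto' 0 0
        (by simp)).mono_left nhdsWithin_le_nhds
    refine tendsto_of_tendsto_of_tendsto_of_le_of_le' tendsto_const_nhds hlim
      (.of_forall fun _ => zero_le) ?_
    filter_upwards [(eventually_abs_mul_le_one K).filter_mono nhdsWithin_le_nhds,
      self_mem_nhdsWithin] with ε hε hε0
    refine (eLpNorm_le_of_ae_bound (C := |ε| * (K ^ 2 / 2)) ?_).trans_eq (by simp)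
    filter_upwards [density_self P, density_tilt hm hK h0 hε] with z hz hz'
    rw [hz, hz', Real.sqrt_one, mul_one]
    exact abs_sqrt_one_add_mul_quotient_sub_le (hK z) hε hε0

end Tilt

lemma exists_bounded_mean_zero {P : ProbabilityMeasure Z} {φ : Z → ℝ}
    (hφ : MemLp φ 2 (P : Measure Z)) (hφ0 : ∫ z, φ z ∂(P : Measure Z) = 0) {η : ℝ≥0∞}
    (hη : 0 < η) :
    ∃ h : Z → ℝ, Measurable h ∧ (∃ K, ∀ z, |h z| ≤ K) ∧ ∫ z, h z ∂(P : Measure Z) = 0 ∧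
      eLpNorm (fun z => φ z - h z) 2 (P : Measure Z) < η := by
  obtain ⟨s, hs, hs2⟩ := hφ.exists_simpleFunc_eLpNorm_sub_lt (by norm_num)
    (ENNReal.half_pos hη.ne').ne'
  obtain ⟨C, hC⟩ := s.exists_forall_norm_le
  have hsi : Integrable s (P : Measure Z) := hs2.integrable one_le_two
  set c := ∫ z, s z ∂(P : Measure Z) with hc
  have hc_eq : c = -∫ z, (φ - ⇑s) z ∂(P : Measure Z) := by
    simp only [Pi.sub_apply]
    rw [integral_sub (hφ.integrable one_le_two) hsi, hφ0, zero_sub, neg_neg]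
  have hc_le : eLpNorm (fun _ => c) 2 (P : Measure Z) ≤ eLpNorm (φ - ⇑s) 2 (P : Measure Z) := by
    rw [eLpNorm_const c two_ne_zero (NeZero.ne _), measure_univ, ENNReal.one_rpow, mul_one,
      hc_eq, enorm_neg]
    refine (enorm_integral_le_lintegral_enorm _).trans ?_
    rw [← eLpNorm_one_eq_lintegral_enorm]
    exact eLpNorm_le_eLpNorm_of_exponent_le one_le_two (hφ.1.sub hs2.1)
  refine ⟨fun z => s z - c, s.measurable.sub_const c,
    ⟨C + |c|, fun z => (abs_sub _ _).trans (by gcongr; exact hC z)⟩, ?_, ?_⟩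
  · rw [integral_sub hsi (integrable_const c)]
    simp [hc]
  · calc eLpNorm (fun z => φ z - (s z - c)) 2 (P : Measure Z)
        = eLpNorm ((φ - ⇑s) + fun _ => c) 2 (P : Measure Z) := by
          congr 1
          funext z
          simp only [Pi.add_apply, Pi.sub_apply, sub_sub_eq_add_sub, sub_add_eq_add_sub]
      _ ≤ eLpNorm (φ - ⇑s) 2 (P : Measure Z) + eLpNorm (fun _ => c) 2 (P : Measure Z) :=
          eLpNorm_add_le (hφ.1.sub hs2.1) aestronglyMeasurable_const one_le_two
      _ < η / 2 + η / 2 := ENNReal.add_lt_add hs (hc_le.trans_lt hs)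
      _ = η := ENNReal.add_halves η

end Tangent

end Efficiency

namespace Incremental

open Efficiency

section Restriction

variable {T : ℕ} {X : Fin T → Type*} {α : Type*} {S S' U U' : Set (Fin T)} {F : Traj X → α}

/-- The part of a trajectory consisting of the covariates at the times in `S` and the treatments
at the times in `S'`; `hist` and `prev` are the cases used by the statistical model. -/
def restr (S S' : Set (Fin T)) (w : Traj X) : ((s : S) → X s) × (S' → Bool) :=
  (fun s => w.1 s, fun s => w.2 s)

/-- `F` is a function of the covariates at the times in `S` and of the treatments at the times
in `S'`. -/
def DependsOnly (S S' : Set (Fin T)) (F : Traj X → α) : Prop :=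
  ∀ w w' : Traj X, (∀ s ∈ S, w.1 s = w'.1 s) → (∀ s ∈ S', w.2 s = w'.2 s) → F w = F w'

lemma dependsOnly_restr (S S' : Set (Fin T)) : DependsOnly S S' (restr S S' : Traj X → _) :=
  fun _ _ hx ha => Prod.ext (funext fun s => hx s s.2) (funext fun s => ha s s.2)

lemma DependsOnly.mono (h : DependsOnly S S' F) (hS : S ⊆ U) (hS' : S' ⊆ U') :
    DependsOnly U U' F :=
  fun w w' hx ha => h w w' (fun s hs => hx s (hS hs)) fun s hs => ha s (hS' hs)

lemma DependsOnly.update_covariate (h : DependsOnly S S' F) (t : Fin T) (x : X t) :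
    DependsOnly (S \ {t}) S' fun w => F (Function.update w.1 t x, w.2) := by
  refine fun w w' hx ha => h _ _ (fun s hs => ?_) ha
  rcases eq_or_ne s t with rfl | hst
  · simp
  · simpa only [Function.update_of_ne hst] using hx s ⟨hs, hst⟩

lemma DependsOnly.update_treatment (h : DependsOnly S S' F) (t : Fin T) (b : Bool) :
    DependsOnly S (S' \ {t}) fun w => F (w.1, Function.update w.2 t b) := by
  refine fun w w' hx ha => h _ _ hx fun s hs => ?_
  rcases eq_or_ne s t with rfl | hst
  · simp
  · simpa only [Function.update_of_ne hst] using ha s ⟨hs, hst⟩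

lemma DependsOnly.apply_update_treatment {t : Fin T} (h : DependsOnly S S' F) (ht : t ∉ S')
    (w : Traj X) (b : Bool) : F (w.1, Function.update w.2 t b) = F w :=
  h _ _ (fun _ _ => rfl) fun _ hs => Function.update_of_ne (ne_of_mem_of_not_mem hs ht) _ _

lemma DependsOnly.apply_update_covariate {t : Fin T} (h : DependsOnly S S' F) (ht : t ∉ S)
    (w : Traj X) (x : X t) : F (Function.update w.1 t x, w.2) = F w :=
  h _ _ (fun _ hs => Function.update_of_ne (ne_of_mem_of_not_mem hs ht) _ _) fun _ _ => rfl

open Classical in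
/-- The trajectory which extends a partial trajectory by arbitrary values; a right inverse of
`restr`. -/
noncomputable def extend [∀ t, Nonempty (X t)] (S S' : Set (Fin T))
    (p : ((s : S) → X s) × (S' → Bool)) : Traj X :=
  (fun s => if h : s ∈ S then p.1 ⟨s, h⟩ else Classical.arbitrary _,
    fun s => if h : s ∈ S' then p.2 ⟨s, h⟩ else false)

lemma DependsOnly.apply_extend_restr [∀ t, Nonempty (X t)] (h : DependsOnly S S' F) (w : Traj X) :
    F (extend S S' (restr S S' w)) = F w :=
  h _ _ (fun s hs => by simp [extend, restr, hs]) fun s hs => by simp [extend, restr, hs]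

variable [∀ t, MeasurableSpace (X t)]

/-- The σ-algebra on observations generated by the covariates at the times in `S` and the
treatments at the times in `S'`. -/
abbrev restrAlg (X : Fin T → Type*) [∀ t, MeasurableSpace (X t)] (S S' : Set (Fin T)) :
    MeasurableSpace (Obs X) :=
  MeasurableSpace.comap (fun z : Obs X => restr S S' z.1) inferInstance

lemma measurable_restr (S S' : Set (Fin T)) : Measurable (restr S S' : Traj X → _) := by
  unfold restr
  fun_prop

lemma restrAlg_le (S S' : Set (Fin T)) :
    restrAlg X S S' ≤ (inferInstance : MeasurableSpace (Obs X)) :=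
  ((measurable_restr S S').comp measurable_fst).comap_le

variable [∀ t, Nonempty (X t)]

lemma measurable_extend (S S' : Set (Fin T)) : Measurable (extend S S' : _ → Traj X) := by
  unfold extend
  refine .prodMk (measurable_pi_lambda _ fun s => ?_) (measurable_pi_lambda _ fun s => ?_) <;>
    split_ifs <;> fun_prop

lemma DependsOnly.measurable [MeasurableSpace α] (h : DependsOnly S S' F) (hF : Measurable F) :
    Measurable[restrAlg X S S'] fun z : Obs X => F z.1 := by
  have hfactor : (fun z : Obs X => F z.1) =
      (fun p => F (extend S S' p)) ∘ fun z : Obs X => restr S S' z.1 :=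
    funext fun z => (h.apply_extend_restr z.1).symm
  rw [hfactor]
  exact (hF.comp (measurable_extend S S')).comp (comap_measurable _)

lemma restrAlg_mono (hS : S ⊆ U) (hS' : S' ⊆ U') : restrAlg X S S' ≤ restrAlg X U U' :=
  (((dependsOnly_restr S S').mono hS hS').measurable (measurable_restr S S')).comap_le

lemma restrAlg_univ :
    restrAlg X Set.univ Set.univ = MeasurableSpace.comap (fun z : Obs X => z.1) inferInstance := by
  have hid : DependsOnly Set.univ Set.univ (id : Traj X → Traj X) := fun w w' hx ha =>
    Prod.ext (funext fun s => hx s trivial) (funext fun s => ha s trivial)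
  refine le_antisymm ?_ (hid.measurable measurable_id).comap_le
  exact ((measurable_restr _ _).comp (comap_measurable fun z : Obs X => z.1)).comap_le

lemma condExp_restrAlg {P : Measure (Obs X)} [IsFiniteMeasure P] {Ω : Type*} [MeasurableSpace Ω]
    [StandardBorelSpace Ω] [Nonempty Ω] {V : Traj X → Ω} {G : Traj X × Ω → ℝ}
    (hV : Measurable V) (hG : Measurable G) (hdep : ∀ v, DependsOnly S S' fun w => G (w, v))
    (hint : Integrable (fun z : Obs X => G (z.1, V z.1)) P) :
    P[fun z => G (z.1, V z.1) | restrAlg X S S'] =ᵐ[P] fun z => ∫ v, G (z.1, v)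
      ∂condDistrib (fun z : Obs X => V z.1) (fun z : Obs X => restr S S' z.1) P
        (restr S S' z.1) := by
  have hext : ∀ w v, G (extend S S' (restr S S' w), v) = G (w, v) :=
    fun w v => (hdep v).apply_extend_restr w
  have hmeas : Measurable fun q : (((s : S) → X s) × (S' → Bool)) × Ω =>
      G (extend S S' q.1, q.2) :=
    hG.comp (((measurable_extend S S').comp measurable_fst).prodMk measurable_snd)
  have hcond := condExp_prod_ae_eq_integral_condDistrib (μ := P)
    ((measurable_restr S S').comp measurable_fst) (hV.comp measurable_fst).aemeasurable
    hmeas.stronglyMeasurable (by simpa only [Function.comp_apply, hext] using hint)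
  simp only [Function.comp_apply, hext] at hcond
  exact hcond

end Restriction

section CondExp

variable {T : ℕ} {X : Fin T → Type*} [∀ t, MeasurableSpace (X t)]
  {P : ProbabilityMeasure (Obs X)} {t : Fin T} {F : Traj X → ℝ}

lemma dependsOnly_propensity (P : ProbabilityMeasure (Obs X)) (t : Fin T) :
    DependsOnly (Set.Iic t) (Set.Iio t) (propensity P t) := fun w w' hx ha => by
  have : hist t w = hist t w' := dependsOnly_restr _ _ w w' hx ha
  simp only [propensity, this]

lemma measurable_propensity (P : ProbabilityMeasure (Obs X)) (t : Fin T) :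
    Measurable (propensity P t) :=
  ((Kernel.measurable_coe _ (measurableSet_singleton _)).ennreal_toReal).comp
    (measurable_restr (Set.Iic t) (Set.Iio t))

lemma propensity_mem_Icc (P : ProbabilityMeasure (Obs X)) (t : Fin T) (w : Traj X) :
    propensity P t w ∈ Set.Icc (0 : ℝ) 1 :=
  ⟨measureReal_nonneg, measureReal_le_one⟩

lemma propensity_update_treatment (P : ProbabilityMeasure (Obs X)) (t : Fin T) (w : Traj X)
    (b : Bool) : propensity P t (w.1, Function.update w.2 t b) = propensity P t w :=
  (dependsOnly_propensity P t).apply_update_treatment (lt_irrefl t) w b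

lemma ind_mem_Icc (b : Bool) : ind b ∈ Set.Icc (0 : ℝ) 1 := by
  cases b <;> simp [ind]

lemma measurable_ind_treatment (t : Fin T) : Measurable fun w : Traj X => ind (w.2 t) :=
  (measurable_of_countable ind).comp (by fun_prop)

lemma integral_bool (μ : Measure Bool) [IsProbabilityMeasure μ] (f : Bool → ℝ) :
    ∫ b, f b ∂μ = μ.real {true} * f true + (1 - μ.real {true}) * f false := by
  have hcompl : ({true}ᶜ : Set Bool) = {false} := by ext b; cases b <;> simp
  have hfalse : μ.real {false} = 1 - μ.real {true} := by
    rw [← hcompl, probReal_compl_eq_one_sub (measurableSet_singleton true)]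
  rw [integral_fintype .of_finite, Fintype.sum_bool, hfalse, smul_eq_mul, smul_eq_mul]

lemma condExp_hist [∀ t, Nonempty (X t)] (hF : Measurable F)
    (hd : DependsOnly (Set.Iic t) (Set.Iic t) F)
    (hi : Integrable (fun z : Obs X => F z.1) P) :
    (P : Measure (Obs X))[fun z => F z.1 | restrAlg X (Set.Iic t) (Set.Iio t)]
      =ᵐ[(P : Measure (Obs X))] fun z =>
      propensity P t z.1 * F (z.1.1, Function.update z.1.2 t true) +
        (1 - propensity P t z.1) * F (z.1.1, Function.update z.1.2 t false) := by
  have hcond := condExp_restrAlg (P := P) (S := Set.Iic t) (S' := Set.Iio t)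
    (V := fun w : Traj X => w.2 t) (G := fun q => F (q.1.1, Function.update q.1.2 t q.2))
    (by fun_prop)
    (hF.comp ((measurable_fst.comp measurable_fst).prodMk
      (measurable_update'.comp ((measurable_snd.comp measurable_fst).prodMk measurable_snd))))
    (fun b => Set.Iic_sdiff_right (a := t) ▸ hd.update_treatment t b)
    (by simpa only [Function.update_eq_self] using hi)
  simp only [Function.update_eq_self, integral_bool] at hcond
  exact hcond

lemma condExp_treatment [∀ t, Nonempty (X t)] (P : ProbabilityMeasure (Obs X)) (t : Fin T) :
    (P : Measure (Obs X))[fun z => ind (z.1.2 t) | restrAlg X (Set.Iic t) (Set.Iio t)]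
      =ᵐ[(P : Measure (Obs X))] fun z => propensity P t z.1 := by
  have hm := measurable_ind_treatment (X := X) t
  refine (condExp_hist hm (fun w w' _ ha => by simp [ha t (Set.mem_Iic.2 le_rfl)])
    (.of_bound (hm.comp measurable_fst).aestronglyMeasurable 1
      (.of_forall fun z => ?_))).trans (.of_forall fun z => by simp [ind])
  rw [Real.norm_of_nonneg (ind_mem_Icc _).1]
  exact (ind_mem_Icc _).2

lemma condExp_prev [∀ t, StandardBorelSpace (X t)] [∀ t, Nonempty (X t)] (hF : Measurable F)
    (hd : DependsOnly (Set.Iic t) (Set.Iio t) F)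
    (hi : Integrable (fun z : Obs X => F z.1) P) :
    (P : Measure (Obs X))[fun z => F z.1 | restrAlg X (Set.Iio t) (Set.Iio t)]
      =ᵐ[(P : Measure (Obs X))] fun z =>
      ∫ x, F (Function.update z.1.1 t x, z.1.2) ∂covLaw P t z.1 := by
  have hcond := condExp_restrAlg (P := P) (S := Set.Iio t) (S' := Set.Iio t)
    (V := fun w : Traj X => w.1 t) (G := fun q => F (Function.update q.1.1 t q.2, q.1.2))
    (by fun_prop)
    (hF.comp ((measurable_update'.comp
      ((measurable_fst.comp measurable_fst).prodMk measurable_snd)).prodMk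
        (measurable_snd.comp measurable_fst)))
    (fun x => Set.Iic_sdiff_right (a := t) ▸ hd.update_covariate t x)
    (by simpa only [Function.update_eq_self] using hi)
  simp only [Function.update_eq_self] at hcond
  exact hcond

end CondExp

section Weights

variable {T : ℕ} {X : Fin T → Type*} [∀ t, MeasurableSpace (X t)] {δ : ℝ}
  {P : ProbabilityMeasure (Obs X)}

lemma le_denom (P : ProbabilityMeasure (Obs X)) (t : Fin T) (w : Traj X) :
    min 1 δ ≤ denom δ P t w := by
  obtain ⟨h0, h1⟩ := propensity_mem_Icc P t w
  unfold denom
  rcases le_total 1 δ with h | h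
  · rw [min_eq_left h]; nlinarith
  · rw [min_eq_right h]; nlinarith

lemma denom_pos (hδ : 0 < δ) (P : ProbabilityMeasure (Obs X)) (t : Fin T) (w : Traj X) :
    0 < denom δ P t w :=
  (lt_min one_pos hδ).trans_le (le_denom P t w)

lemma dependsOnly_denom (P : ProbabilityMeasure (Obs X)) (t : Fin T) :
    DependsOnly (Set.Iic t) (Set.Iio t) (denom δ P t) := fun w w' hx ha => by
  simp only [denom, dependsOnly_propensity P t w w' hx ha]

lemma denom_update_treatment (P : ProbabilityMeasure (Obs X)) (t : Fin T) (w : Traj X)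
    (b : Bool) : denom δ P t (w.1, Function.update w.2 t b) = denom δ P t w :=
  (dependsOnly_denom P t).apply_update_treatment (lt_irrefl t) w b

lemma measurable_denom (P : ProbabilityMeasure (Obs X)) (t : Fin T) :
    Measurable (denom δ P t) := by
  have := measurable_propensity P t
  unfold denom
  fun_prop

lemma dependsOnly_weight (P : ProbabilityMeasure (Obs X)) (t : Fin T) :
    DependsOnly (Set.Iic t) (Set.Iic t) (weight δ P t) := fun w w' hx ha => by
  simp only [weight, ha t (Set.mem_Iic.2 le_rfl),
    dependsOnly_denom P t w w' hx fun s hs => ha s (Set.Iio_subset_Iic_self hs)]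

lemma measurable_weight (P : ProbabilityMeasure (Obs X)) (t : Fin T) :
    Measurable (weight δ P t) := by
  have := measurable_denom (δ := δ) P t
  have := measurable_ind_treatment (X := X) t
  unfold weight
  fun_prop

lemma abs_treatment_factor_le (hδ : 0 < δ) (b : Bool) : |δ * ind b + 1 - ind b| ≤ δ + 1 := by
  obtain ⟨h0, h1⟩ := ind_mem_Icc b
  rw [abs_le]
  constructor <;> nlinarith

lemma abs_weight_le (hδ : 0 < δ) (P : ProbabilityMeasure (Obs X)) (t : Fin T) (w : Traj X) :
    |weight δ P t w| ≤ (δ + 1) / min 1 δ := by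
  rw [weight, abs_div, abs_of_pos (denom_pos hδ P t w)]
  exact div_le_div₀ (by linarith) (abs_treatment_factor_le hδ _) (lt_min one_pos hδ)
    (le_denom P t w)

lemma abs_prod_weight_le (hδ : 0 < δ) (P : ProbabilityMeasure (Obs X)) (S : Finset (Fin T))
    (w : Traj X) : |∏ s ∈ S, weight δ P s w| ≤ ((δ + 1) / min 1 δ) ^ S.card := by
  rw [Finset.abs_prod, ← Finset.prod_const]
  exact Finset.prod_le_prod (fun _ _ => abs_nonneg _) fun s _ => abs_weight_le hδ P s w

lemma measurable_prod_weight (P : ProbabilityMeasure (Obs X)) (S : Finset (Fin T)) :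
    Measurable fun w : Traj X => ∏ s ∈ S, weight δ P s w :=
  Finset.measurable_fun_prod S fun s _ => measurable_weight P s

lemma dependsOnly_prod_weight_Iio (P : ProbabilityMeasure (Obs X)) (t : Fin T) :
    DependsOnly (Set.Iic t) (Set.Iio t) fun w : Traj X => ∏ s ∈ Finset.Iio t, weight δ P s w :=
  fun w w' hx ha => Finset.prod_congr rfl fun s hs =>
    dependsOnly_weight P s w w' (fun i hi => hx i (le_trans hi (Finset.mem_Iio.1 hs).le))
      fun i hi => ha i (lt_of_le_of_lt hi (Finset.mem_Iio.1 hs))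

lemma measurable_outcomeReg (P : ProbabilityMeasure (Obs X)) : Measurable (outcomeReg P) :=
  (StronglyMeasurable.integral_kernel_prod_right' (f := fun p : Traj X × ℝ => p.2)
    measurable_snd.stronglyMeasurable).measurable

lemma integrable_prod_weight_mul (hδ : 0 < δ)
    (hY : Integrable (fun z : Obs X => z.2) (P : Measure (Obs X))) (S : Finset (Fin T)) :
    Integrable (fun z : Obs X => (∏ s ∈ S, weight δ P s z.1) * z.2) (P : Measure (Obs X)) :=
  hY.bdd_mul ((measurable_prod_weight P S).comp measurable_fst).aestronglyMeasurable
    (.of_forall fun z => abs_prod_weight_le hδ P S z.1)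

lemma dependsOnly_intervention (P : ProbabilityMeasure (Obs X)) (t : Fin T) :
    DependsOnly (Set.Iic t) (Set.Iic t) (intervention δ P t) := fun w w' hx ha => by
  have ha' : ∀ s ∈ Set.Iio t, w.2 s = w'.2 s := fun s hs => ha s (Set.Iio_subset_Iic_self hs)
  simp only [intervention, ha t (Set.mem_Iic.2 le_rfl), dependsOnly_propensity P t w w' hx ha',
    dependsOnly_denom P t w w' hx ha']

lemma measurable_intervention (P : ProbabilityMeasure (Obs X)) (t : Fin T) :
    Measurable (intervention δ P t) := by
  have := measurable_denom (δ := δ) P t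
  have := measurable_propensity P t
  have := measurable_ind_treatment (X := X) t
  unfold intervention
  fun_prop

lemma measurable_update_treatment (t : Fin T) (b : Bool) :
    Measurable fun w : Traj X => ((w.1, Function.update w.2 t b) : Traj X) :=
  measurable_fst.prodMk (measurable_update'.comp (measurable_snd.prodMk measurable_const))

lemma prod_filter_le {M : Type*} [CommMonoid M] (f : Fin T → M) (t : Fin T) :
    ∏ s with t.val ≤ s.val, f s = f t * ∏ s with t.val + 1 ≤ s.val, f s := by
  rw [← Finset.prod_insert (by simp)]
  congr 1
  ext s
  simp only [Finset.mem_filter, Finset.mem_univ, true_and, Finset.mem_insert, Fin.ext_iff]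
  omega

/-- The product of the weights at the times `t + 1, …, T`. -/
noncomputable def futureWeight (δ : ℝ) (P : ProbabilityMeasure (Obs X)) (t : ℕ) (w : Traj X) : ℝ :=
  ∏ s with t ≤ s.val, weight δ P s w

lemma futureWeight_eq_mul (P : ProbabilityMeasure (Obs X)) (t : Fin T) (w : Traj X) :
    futureWeight δ P t w = weight δ P t w * futureWeight δ P (t + 1) w :=
  prod_filter_le _ t

lemma integrable_futureWeight_mul (hδ : 0 < δ)
    (hY : Integrable (fun z : Obs X => z.2) (P : Measure (Obs X))) (t : ℕ) :
    Integrable (fun z : Obs X => futureWeight δ P t z.1 * z.2) (P : Measure (Obs X)) :=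
  integrable_prod_weight_mul hδ hY _

lemma prod_weight_eq_mul_futureWeight (P : ProbabilityMeasure (Obs X)) (t : Fin T) (w : Traj X) :
    ∏ s, weight δ P s w = (∏ s ∈ Finset.Iio t, weight δ P s w) * futureWeight δ P t w := by
  rw [futureWeight, ← Finset.prod_filter_mul_prod_filter_not Finset.univ (· < t)]
  congr 2 <;> ext s <;> simp

end Weights

section PseudoRegression

variable {T : ℕ} {X : Fin T → Type*} [∀ t, MeasurableSpace (X t)]
  [∀ t, StandardBorelSpace (X t)] [∀ t, Nonempty (X t)] {δ : ℝ} {P : ProbabilityMeasure (Obs X)}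

lemma integrateAfter_eq (P : ProbabilityMeasure (Obs X)) (t : Fin T) (F : Traj X → ℝ) :
    integrateAfter P t F = integrateTime P t (integrateAfter P (t + 1) F) := by
  unfold integrateAfter
  rw [List.drop_eq_getElem_cons (by simp), List.foldr_cons, List.getElem_finRange]
  simp

lemma integrateAfter_top (P : ProbabilityMeasure (Obs X)) (F : Traj X → ℝ) :
    integrateAfter P T F = F := by
  rw [integrateAfter, List.drop_eq_nil_of_le (by simp), List.foldr_nil]

lemma integrateTime_mul (P : ProbabilityMeasure (Obs X)) (t : Fin T) {c : Traj X → ℝ}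
    (hc : DependsOnly (Set.Iio t) (Set.Iio t) c) (G : Traj X → ℝ) :
    integrateTime P t (fun w => c w * G w) = fun w => c w * integrateTime P t G w := by
  funext w
  have hupdate : ∀ x b, c (Function.update w.1 t x, Function.update w.2 t b) = c w := fun x b =>
    (hc.apply_update_treatment (lt_irrefl t) (Function.update w.1 t x, w.2) b).trans
      (hc.apply_update_covariate (lt_irrefl t) w x)
  simp only [integrateTime, hupdate, ← Finset.mul_sum, integral_const_mul]

lemma setOf_val_lt_succ (t : Fin T) : {s : Fin T | s.val < t.val + 1} = Set.Iic t := by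
  ext s
  simp

lemma integrateAfter_mul (P : ProbabilityMeasure (Obs X)) {t : ℕ} (ht : t ≤ T) {c : Traj X → ℝ}
    (hc : DependsOnly {s | s.val < t} {s | s.val < t} c) (F : Traj X → ℝ) :
    integrateAfter P t (fun w => c w * F w) = fun w => c w * integrateAfter P t F w := by
  induction ht using Nat.decreasingInduction with
  | self => simp only [integrateAfter_top]
  | of_succ t ht ih =>
    have hc' := hc.mono (U := {s | s.val < t + 1}) (U' := {s | s.val < t + 1})
      (fun s hs => Nat.lt_succ_of_lt hs) (fun s hs => Nat.lt_succ_of_lt hs)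
    calc integrateAfter P t (fun w => c w * F w)
        = integrateTime P ⟨t, ht⟩ (integrateAfter P (t + 1) fun w => c w * F w) :=
          integrateAfter_eq P ⟨t, ht⟩ _
      _ = fun w => c w * integrateTime P ⟨t, ht⟩ (integrateAfter P (t + 1) F) w := by
          rw [ih hc']; exact integrateTime_mul P ⟨t, ht⟩ hc _
      _ = fun w => c w * integrateAfter P t F w := by rw [← integrateAfter_eq P ⟨t, ht⟩ F]

lemma dependsOnly_pseudoReg_succ (P : ProbabilityMeasure (Obs X)) (t : Fin T) :
    DependsOnly (Set.Iic t) (Set.Iic t) (pseudoReg δ P (t + 1)) := fun w w' hx ha =>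
  integrateAfter_congr P _ (T - (t + 1)) (t + 1) (by omega) w w'
    (fun s hs => hx s (Nat.lt_succ_iff.1 hs)) fun s hs => ha s (Nat.lt_succ_iff.1 hs)

lemma pseudoReg_top (P : ProbabilityMeasure (Obs X)) : pseudoReg δ P T = outcomeReg P := by
  have hempty : Finset.univ.filter (fun s : Fin T => T ≤ (s : ℕ)) = ∅ := by
    ext s
    simp
  simp only [pseudoReg, integrateAfter_top, hempty, Finset.prod_empty, mul_one]

lemma pseudoReg_eq_integrateTime (P : ProbabilityMeasure (Obs X)) (t : Fin T) :
    pseudoReg δ P t =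
      integrateTime P t fun w => intervention δ P t w * pseudoReg δ P (t + 1) w := by
  have hdep : DependsOnly {s | s.val < t.val + 1} {s | s.val < t.val + 1}
      (intervention δ P t) :=
    setOf_val_lt_succ t ▸ dependsOnly_intervention P t
  unfold pseudoReg
  rw [integrateAfter_eq, ← integrateAfter_mul P t.2 hdep]
  congr 2
  funext w
  rw [prod_filter_le, mul_left_comm]

lemma measurable_integrateTime (P : ProbabilityMeasure (Obs X)) (t : Fin T) {G : Traj X → ℝ}
    (hG : Measurable G) : Measurable (integrateTime P t G) := by
  let κ : Kernel (Traj X) (X t) := (condDistrib (fun z : Obs X => z.1.1 t)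
    (fun z : Obs X => prev t z.1) (P : Measure (Obs X))).comap (prev t)
    (measurable_restr (Set.Iio t) (Set.Iio t))
  have : IsMarkovKernel κ := Kernel.IsMarkovKernel.comap _ _
  have hsum : Measurable fun q : Traj X × X t =>
      ∑ b : Bool, G (Function.update q.1.1 t q.2, Function.update q.1.2 t b) :=
    Finset.measurable_fun_sum _ fun b _ =>
      hG.comp ((measurable_update_treatment t b).comp
        ((measurable_update'.comp ((measurable_fst.comp measurable_fst).prodMk
          measurable_snd)).prodMk (measurable_snd.comp measurable_fst)))
  exact (StronglyMeasurable.integral_kernel_prod_right' (κ := κ) hsum.stronglyMeasurable).measurable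

lemma measurable_integrateAfter (P : ProbabilityMeasure (Obs X)) (t : ℕ) {F : Traj X → ℝ}
    (hF : Measurable F) : Measurable (integrateAfter P t F) := by
  unfold integrateAfter
  induction (List.finRange T).drop t with
  | nil => exact hF
  | cons s l ih => exact measurable_integrateTime P s ih

lemma measurable_pseudoReg (P : ProbabilityMeasure (Obs X)) (t : ℕ) :
    Measurable (pseudoReg δ P t) :=
  measurable_integrateAfter P t ((measurable_outcomeReg P).mul
    (Finset.measurable_fun_prod _ fun s _ => measurable_intervention P s))

/-- The regression of `weight_t * m_t(H_t, A_t)` on the history `H_t`. With the weights of the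
earlier times it is the regression of the fully weighted outcome on `H_t`, see
`condExp_prod_weight_mul`. -/
noncomputable def histReg (δ : ℝ) (P : ProbabilityMeasure (Obs X)) (t : Fin T) (w : Traj X) : ℝ :=
  (δ * propensity P t w * pseudoReg δ P (t + 1) (w.1, Function.update w.2 t true)
    + (1 - propensity P t w) * pseudoReg δ P (t + 1) (w.1, Function.update w.2 t false)) /
      denom δ P t w

lemma measurable_histReg (P : ProbabilityMeasure (Obs X)) (t : Fin T) :
    Measurable (histReg δ P t) := by
  have hm : ∀ b, Measurable fun w : Traj X =>
      pseudoReg δ P (t + 1) (w.1, Function.update w.2 t b) := fun b =>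
    (measurable_pseudoReg P (t + 1)).comp (measurable_update_treatment t b)
  have hp := measurable_propensity P t
  exact (((hp.const_mul δ).mul (hm true)).add ((hp.const_sub 1).mul (hm false))).div
    (measurable_denom P t)

lemma dependsOnly_histReg (P : ProbabilityMeasure (Obs X)) (t : Fin T) :
    DependsOnly (Set.Iic t) (Set.Iio t) (histReg δ P t) := fun w w' hx ha => by
  have hm : ∀ b, pseudoReg δ P (t + 1) (w.1, Function.update w.2 t b) =
      pseudoReg δ P (t + 1) (w'.1, Function.update w'.2 t b) := fun b =>
    (dependsOnly_pseudoReg_succ P t).update_treatment t b w w' hx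
      (by rwa [Set.Iic_sdiff_right])
  simp only [histReg, hm, dependsOnly_propensity P t w w' hx ha,
    dependsOnly_denom P t w w' hx ha]

lemma sum_intervention_mul_pseudoReg (P : ProbabilityMeasure (Obs X)) (t : Fin T) (w : Traj X) :
    ∑ b : Bool, intervention δ P t (w.1, Function.update w.2 t b) *
      pseudoReg δ P (t + 1) (w.1, Function.update w.2 t b) = histReg δ P t w := by
  simp only [Fintype.sum_bool, intervention, histReg, propensity_update_treatment,
    denom_update_treatment, Function.update_self, ind, if_true, Bool.false_eq_true, if_false]
  ring

lemma mean_weight_mul_pseudoReg (P : ProbabilityMeasure (Obs X)) (t : Fin T) (w : Traj X) :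
    propensity P t w * (weight δ P t (w.1, Function.update w.2 t true) *
        pseudoReg δ P (t + 1) (w.1, Function.update w.2 t true)) +
      (1 - propensity P t w) * (weight δ P t (w.1, Function.update w.2 t false) *
        pseudoReg δ P (t + 1) (w.1, Function.update w.2 t false)) = histReg δ P t w := by
  simp only [weight, histReg, denom_update_treatment, Function.update_self, ind, if_true,
    Bool.false_eq_true, if_false]
  ring

lemma pseudoReg_eq_integral_histReg (P : ProbabilityMeasure (Obs X)) (t : Fin T) (w : Traj X) :
    pseudoReg δ P t w = ∫ x, histReg δ P t (Function.update w.1 t x, w.2) ∂covLaw P t w := by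
  rw [pseudoReg_eq_integrateTime, integrateTime]
  congr 1
  funext x
  exact sum_intervention_mul_pseudoReg P t (Function.update w.1 t x, w.2)

lemma condExp_futureWeight_mul_of_succ (hδ : 0 < δ)
    (hY : Integrable (fun z : Obs X => z.2) (P : Measure (Obs X))) {t : Fin T}
    (hsucc : (P : Measure (Obs X))[fun z => futureWeight δ P (t + 1) z.1 * z.2 |
        restrAlg X (Set.Iic t) (Set.Iic t)]
      =ᵐ[(P : Measure (Obs X))] fun z => pseudoReg δ P (t + 1) z.1) :
    (P : Measure (Obs X))[fun z => futureWeight δ P t z.1 * z.2 |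
        restrAlg X (Set.Iic t) (Set.Iio t)]
      =ᵐ[(P : Measure (Obs X))] fun z => histReg δ P t z.1 := by
  have hfactor : (fun z : Obs X => futureWeight δ P t z.1 * z.2) =
      (fun z => weight δ P t z.1) * fun z => futureWeight δ P (t + 1) z.1 * z.2 := by
    funext z
    rw [futureWeight_eq_mul, mul_assoc, Pi.mul_apply]
  have htreat : (P : Measure (Obs X))[fun z => futureWeight δ P t z.1 * z.2 |
        restrAlg X (Set.Iic t) (Set.Iic t)]
      =ᵐ[(P : Measure (Obs X))] fun z => weight δ P t z.1 * pseudoReg δ P (t + 1) z.1 := by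
    rw [hfactor]
    refine (condExp_mul_of_stronglyMeasurable_left
      ((dependsOnly_weight P t).measurable (measurable_weight P t)).stronglyMeasurable
      (hfactor ▸ integrable_futureWeight_mul hδ hY t)
      (integrable_futureWeight_mul hδ hY _)).trans ?_
    filter_upwards [hsucc] with z hz
    rw [Pi.mul_apply, hz]
  have hhist := condExp_hist (P := P) (t := t)
    (F := fun w => weight δ P t w * pseudoReg δ P (t + 1) w)
    ((measurable_weight P t).mul (measurable_pseudoReg P (t + 1)))
    (fun w w' hx ha => congrArg₂ (· * ·) (dependsOnly_weight P t w w' hx ha)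
      (dependsOnly_pseudoReg_succ P t w w' hx ha))
    (integrable_condExp.congr htreat)
  simp only [mean_weight_mul_pseudoReg] at hhist
  exact (condExp_condExp_of_le (restrAlg_mono le_rfl Set.Iio_subset_Iic_self)
    (restrAlg_le _ _)).symm.trans ((condExp_congr_ae htreat).trans hhist)

lemma condExp_futureWeight_mul (hδ : 0 < δ)
    (hY : Integrable (fun z : Obs X => z.2) (P : Measure (Obs X))) {t : ℕ} (ht : t ≤ T) :
    (P : Measure (Obs X))[fun z => futureWeight δ P t z.1 * z.2 |
        restrAlg X {s | s.val < t} {s | s.val < t}]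
      =ᵐ[(P : Measure (Obs X))] fun z => pseudoReg δ P t z.1 := by
  induction ht using Nat.decreasingInduction with
  | self =>
    have hone : ∀ w : Traj X, futureWeight δ P T w = 1 := fun w =>
      Finset.prod_eq_one fun s hs => absurd (Finset.mem_filter.1 hs).2 s.2.not_ge
    have huniv : {s : Fin T | s.val < T} = Set.univ := by ext s; simp
    simp only [hone, one_mul, pseudoReg_top, huniv, restrAlg_univ]
    exact condExp_ae_eq_integral_condDistrib' measurable_fst hY
  | of_succ t ht ih =>
    have hhist := condExp_futureWeight_mul_of_succ hδ hY (t := ⟨t, ht⟩)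
      (by rw [← setOf_val_lt_succ]; exact ih)
    have hprev := condExp_prev (P := P) (t := ⟨t, ht⟩) (measurable_histReg (δ := δ) P ⟨t, ht⟩)
      (dependsOnly_histReg P _) (integrable_condExp.congr hhist)
    simp only [← pseudoReg_eq_integral_histReg] at hprev
    exact (condExp_condExp_of_le (restrAlg_mono Set.Iio_subset_Iic_self le_rfl)
      (restrAlg_le _ _)).symm.trans ((condExp_congr_ae hhist).trans hprev)

lemma condExp_prod_weight_mul (hδ : 0 < δ)
    (hY : Integrable (fun z : Obs X => z.2) (P : Measure (Obs X))) (t : Fin T) :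
    (P : Measure (Obs X))[fun z => (∏ s, weight δ P s z.1) * z.2 |
        restrAlg X (Set.Iic t) (Set.Iio t)]
      =ᵐ[(P : Measure (Obs X))] fun z =>
        (∏ s ∈ Finset.Iio t, weight δ P s z.1) * histReg δ P t z.1 := by
  have hfuture := condExp_futureWeight_mul_of_succ hδ hY (t := t)
    (setOf_val_lt_succ t ▸ condExp_futureWeight_mul hδ hY (t := t + 1) t.2)
  have hfactor : (fun z : Obs X => (∏ s, weight δ P s z.1) * z.2) =
      (fun z => ∏ s ∈ Finset.Iio t, weight δ P s z.1) * fun z => futureWeight δ P t z.1 * z.2 := by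
    funext z
    rw [prod_weight_eq_mul_futureWeight P t, mul_assoc, Pi.mul_apply]
  rw [hfactor]
  refine (condExp_mul_of_stronglyMeasurable_left
    ((dependsOnly_prod_weight_Iio P t).measurable (measurable_prod_weight P _)).stronglyMeasurable
    (hfactor ▸ integrable_prod_weight_mul hδ hY _) (integrable_futureWeight_mul hδ hY t)).trans ?_
  filter_upwards [hfuture] with z hz
  rw [Pi.mul_apply, hz]

theorem effect_eq_integral (hδ : 0 < δ)
    (hY : Integrable (fun z : Obs X => z.2) (P : Measure (Obs X))) :
    effect δ P = ∫ z, (∏ s, weight δ P s z.1) * z.2 ∂(P : Measure (Obs X)) := by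
  calc effect δ P
      = ∫ z, pseudoReg δ P 0 z.1 ∂(P : Measure (Obs X)) := by simp [pseudoReg_zero_eq]
    _ = ∫ z, futureWeight δ P 0 z.1 * z.2 ∂(P : Measure (Obs X)) := by
        rw [← integral_congr_ae (condExp_futureWeight_mul hδ hY T.zero_le)]
        exact integral_condExp (restrAlg_le _ _)
    _ = ∫ z, (∏ s, weight δ P s z.1) * z.2 ∂(P : Measure (Obs X)) := by simp [futureWeight]

end PseudoRegression

section Submodel

variable {T : ℕ} {X : Fin T → Type*} [∀ t, MeasurableSpace (X t)] {P : ProbabilityMeasure (Obs X)}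

lemma submodel_tilt (hY : MemLp (fun z : Obs X => z.2) 2 (P : Measure (Obs X))) {h : Obs X → ℝ}
    (hm : Measurable h) {K : ℝ} (hK : ∀ z, |h z| ≤ K)
    (h0 : ∫ z, h z ∂(P : Measure (Obs X)) = 0) : Submodel P (tilt P h) h := by
  have hfin : ∫⁻ z, ‖z.2‖ₑ ^ 2 ∂(P : Measure (Obs X)) ≠ ∞ := by
    have := lintegral_rpow_enorm_lt_top_of_eLpNorm_lt_top two_ne_zero ENNReal.ofNat_ne_top hY.2
    simpa using this.ne
  refine ⟨isSubmodel_tilt hm hK h0, (2 * ∫⁻ z, ‖z.2‖ₑ ^ 2 ∂(P : Measure (Obs X))).toNNReal, ?_⟩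
  filter_upwards [eventually_abs_mul_le_one K] with ε hε
  rw [ENNReal.coe_toNNReal (ENNReal.mul_ne_top ENNReal.ofNat_ne_top hfin), coe_tilt hm hK h0 hε,
    lintegral_withDensity_eq_lintegral_mul _ (by fun_prop) (by fun_prop),
    ← lintegral_const_mul _ (by fun_prop)]
  refine lintegral_mono fun z => ?_
  simp only [Pi.mul_apply]
  gcongr
  exact ENNReal.ofReal_le_of_le_toReal (one_add_mul_mem_Icc (hK z) hε).2

lemma exists_mem_span_eLpNorm_sub_lt (hY : MemLp (fun z : Obs X => z.2) 2 (P : Measure (Obs X)))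
    {φ : Obs X → ℝ} (hφ : MemLp φ 2 (P : Measure (Obs X)))
    (hφ0 : ∫ z, φ z ∂(P : Measure (Obs X)) = 0) {η : ℝ≥0∞} (hη : 0 < η) :
    ∃ h ∈ Submodule.span ℝ {g : Obs X → ℝ | ∃ Q, Submodel P Q g},
      eLpNorm (fun z => φ z - h z) 2 (P : Measure (Obs X)) < η := by
  obtain ⟨h, hm, ⟨K, hK⟩, h0, hclose⟩ := exists_bounded_mean_zero hφ hφ0 hη
  exact ⟨h, Submodule.subset_span ⟨tilt P h, submodel_tilt hY hm hK h0⟩, hclose⟩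

end Submodel

section InfluenceFunction

variable {T : ℕ} {X : Fin T → Type*} [∀ t, MeasurableSpace (X t)] {δ : ℝ}

/-- The outcome weighted by the product of the incremental weights over all times; its mean is
the incremental effect. -/
noncomputable def weightedOutcome (δ : ℝ) (P : ProbabilityMeasure (Obs X)) (z : Obs X) : ℝ :=
  (∏ t : Fin T, weight δ P t z.1) * z.2

/-- The weighted outcome multiplied by the logarithmic derivative of the weight at time `t`
with respect to `π_t`. -/
noncomputable def scaledOutcome (δ : ℝ) (P : ProbabilityMeasure (Obs X)) (t : Fin T)
    (z : Obs X) : ℝ :=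
  (1 - δ) / denom δ P t z.1 * weightedOutcome δ P z

/-- The conditional covariance of the treatment at time `t` with `g`, given the history. For a
score `g` it is the derivative of the propensity score. -/
noncomputable def treatmentCov (P : ProbabilityMeasure (Obs X)) (t : Fin T) (g : Obs X → ℝ) :
    Obs X → ℝ :=
  condCov (restrAlg X (Set.Iic t) (Set.Iio t)) P (fun z => ind (z.1.2 t))
    (fun z => propensity P t z.1) g

/-- The contribution to the influence function of the estimation of the propensity score at
time `t`. -/
noncomputable def correction (δ : ℝ) (P : ProbabilityMeasure (Obs X)) (t : Fin T) (z : Obs X) : ℝ :=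
  (ind (z.1.2 t) - propensity P t z.1) *
    ((P : Measure (Obs X))[scaledOutcome δ P t | restrAlg X (Set.Iic t) (Set.Iio t)]) z

variable {P : ProbabilityMeasure (Obs X)} {g : Obs X → ℝ}

lemma memLp_weightedOutcome (hδ : 0 < δ)
    (hY : MemLp (fun z : Obs X => z.2) 2 (P : Measure (Obs X))) :
    MemLp (weightedOutcome δ P) 2 (P : Measure (Obs X)) :=
  memLp_bdd_mul hY ((measurable_prod_weight P _).comp measurable_fst).aestronglyMeasurable
    fun z => abs_prod_weight_le hδ P _ z.1

lemma memLp_scaledOutcome (hδ : 0 < δ)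
    (hY : MemLp (fun z : Obs X => z.2) 2 (P : Measure (Obs X))) (t : Fin T) :
    MemLp (scaledOutcome δ P t) 2 (P : Measure (Obs X)) := by
  have hD : Measurable fun z : Obs X => denom δ P t z.1 :=
    (measurable_denom P t).comp measurable_fst
  refine memLp_bdd_mul (C := |1 - δ| / min 1 δ) (memLp_weightedOutcome hδ hY)
    (hD.const_div (1 - δ)).aestronglyMeasurable fun z => ?_
  rw [abs_div, abs_of_pos (denom_pos hδ P t z.1)]
  have := le_denom (δ := δ) P t z.1
  gcongr

variable [∀ t, Nonempty (X t)]

lemma isCondExpFamily_propensity (Q : ℝ → ProbabilityMeasure (Obs X)) (t : Fin T) :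
    IsCondExpFamily (restrAlg X (Set.Iic t) (Set.Iio t)) Q (fun z => ind (z.1.2 t))
      fun ε z => propensity (Q ε) t z.1 where
  le := restrAlg_le _ _
  measurable_var := (measurable_ind_treatment t).comp measurable_fst
  var_mem z := ind_mem_Icc (z.1.2 t)
  stronglyMeasurable ε :=
    ((dependsOnly_propensity (Q ε) t).measurable (measurable_propensity (Q ε) t)).stronglyMeasurable
  mem ε z := propensity_mem_Icc (Q ε) t z.1
  condExp_ae_eq ε := condExp_treatment (Q ε) t

lemma memLp_correction (hδ : 0 < δ)
    (hY : MemLp (fun z : Obs X => z.2) 2 (P : Measure (Obs X))) (t : Fin T) :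
    MemLp (correction δ P t) 2 (P : Measure (Obs X)) :=
  (isCondExpFamily_propensity (fun _ => P) t).memLp_residual_mul
    ((memLp_scaledOutcome hδ hY t).condExp one_le_two) 0

lemma integral_correction_mul (hδ : 0 < δ)
    (hY : MemLp (fun z : Obs X => z.2) 2 (P : Measure (Obs X)))
    (hg : MemLp g 2 (P : Measure (Obs X))) (t : Fin T) :
    ∫ z, correction δ P t z * g z ∂(P : Measure (Obs X)) =
      ∫ z, treatmentCov P t g z * scaledOutcome δ P t z ∂(P : Measure (Obs X)) := by
  have hres := (isCondExpFamily_propensity (fun _ => P) t).memLp_residual_mul hg 0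
  rw [treatmentCov, condCov,
    integral_condExp_mul (restrAlg_le _ _) hres (memLp_scaledOutcome hδ hY t)]
  simp only [correction, mul_right_comm]

lemma hasL2Deriv_denom {ν : Measure (Obs X)} {r : ℝ → Obs X → ℝ}
    {Q : ℝ → ProbabilityMeasure (Obs X)} (M : RootModel ν r Q g) (δ : ℝ) (t : Fin T) :
    HasL2Deriv ν r (fun ε z => denom δ (Q ε) t z.1)
      fun z => (δ - 1) * treatmentCov (Q 0) t g z := by
  have hdenom : ∀ ε w, denom δ (Q ε) t w = (δ - 1) * propensity (Q ε) t w + 1 := fun ε w => by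
    rw [denom]
    ring
  simpa only [hdenom, treatmentCov] using
    ((isCondExpFamily_propensity Q t).hasL2Deriv M).affine (δ - 1) 1

lemma hasL2Deriv_weight (hδ : 0 < δ) {ν : Measure (Obs X)} {r : ℝ → Obs X → ℝ}
    {Q : ℝ → ProbabilityMeasure (Obs X)} (M : RootModel ν r Q g) (t : Fin T) :
    HasL2Deriv ν r (fun ε z => weight δ (Q ε) t z.1) fun z =>
      weight δ (Q 0) t z.1 * ((1 - δ) / denom δ (Q 0) t z.1 * treatmentCov (Q 0) t g z) := by
  have hind : Measurable fun z : Obs X => ind (z.1.2 t) :=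
    (measurable_ind_treatment t).comp measurable_fst
  have hnum : HasL2Deriv ν r (fun _ z => δ * ind (z.1.2 t) + 1 - ind (z.1.2 t)) fun _ => 0 :=
    .const (by fun_prop) fun z => abs_treatment_factor_le hδ (z.1.2 t)
  have hinv := (hasL2Deriv_denom M δ t).inv M (lt_min one_pos hδ) fun ε z => le_denom (Q ε) t z.1
  have hD : ∀ z : Obs X, denom δ (Q 0) t z.1 ≠ 0 := fun z => (denom_pos hδ (Q 0) t z.1).ne'
  simp only [weight, div_eq_mul_inv]
  refine (hnum.mul hinv M).congr_deriv fun z => ?_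
  field_simp [hD z]
  ring

variable [∀ t, StandardBorelSpace (X t)]

lemma eif_eq (hδ : 0 < δ) (P : ProbabilityMeasure (Obs X)) (z : Obs X) :
    eif δ P z = ∑ t : Fin T, (ind (z.1.2 t) - propensity P t z.1) * ((1 - δ) / denom δ P t z.1 *
        ((∏ s ∈ Finset.Iio t, weight δ P s z.1) * histReg δ P t z.1))
      + weightedOutcome δ P z - effect δ P := by
  unfold eif weightedOutcome
  congr 2
  refine Finset.sum_congr rfl fun t _ => ?_
  have hprod : ∏ s ∈ Finset.Iic t, weight δ P s z.1 =
      weight δ P t z.1 * ∏ s ∈ Finset.Iio t, weight δ P s z.1 := by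
    rw [← Finset.Iio_insert, Finset.prod_insert (by simp)]
  have hfactor : (ind (z.1.2 t) * (1 - propensity P t z.1)
      - (1 - ind (z.1.2 t)) * δ * propensity P t z.1) * ((1 - δ) / δ) * weight δ P t z.1 =
      (ind (z.1.2 t) - propensity P t z.1) * ((1 - δ) / denom δ P t z.1) := by
    have hD := (denom_pos hδ P t z.1).ne'
    unfold weight
    cases z.1.2 t <;> simp only [ind, if_true, Bool.false_eq_true, if_false] <;> field_simp <;> ring
  rw [← histReg, hprod]
  linear_combination
    ((∏ s ∈ Finset.Iio t, weight δ P s z.1) * histReg δ P t z.1) * hfactor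

lemma condExp_scaledOutcome (hδ : 0 < δ)
    (hY : MemLp (fun z : Obs X => z.2) 2 (P : Measure (Obs X))) (t : Fin T) :
    (P : Measure (Obs X))[scaledOutcome δ P t | restrAlg X (Set.Iic t) (Set.Iio t)]
      =ᵐ[(P : Measure (Obs X))] fun z => (1 - δ) / denom δ P t z.1 *
        ((∏ s ∈ Finset.Iio t, weight δ P s z.1) * histReg δ P t z.1) := by
  have hD := ((dependsOnly_denom (δ := δ) P t).measurable (measurable_denom P t)).const_div (1 - δ)
  refine (condExp_mul_of_stronglyMeasurable_left hD.stronglyMeasurable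
    ((memLp_scaledOutcome hδ hY t).integrable one_le_two)
    ((memLp_weightedOutcome hδ hY).integrable one_le_two)).trans ?_
  filter_upwards [condExp_prod_weight_mul hδ (hY.integrable one_le_two) t] with z hz
  exact congrArg ((1 - δ) / denom δ P t z.1 * ·) hz

lemma eif_ae_eq (hδ : 0 < δ) (hY : MemLp (fun z : Obs X => z.2) 2 (P : Measure (Obs X))) :
    eif δ P =ᵐ[(P : Measure (Obs X))] fun z =>
      ∑ t, correction δ P t z + weightedOutcome δ P z - effect δ P := by
  filter_upwards [ae_all_iff.2 fun t => condExp_scaledOutcome hδ hY t] with z hz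
  simp only [eif_eq hδ, correction, hz]

lemma memLp_eif (hδ : 0 < δ) (hY : MemLp (fun z : Obs X => z.2) 2 (P : Measure (Obs X))) :
    MemLp (eif δ P) 2 (P : Measure (Obs X)) :=
  (memLp_congr_ae (eif_ae_eq hδ hY)).2
    (((memLp_finsetSum _ fun t _ => memLp_correction hδ hY t).add
      (memLp_weightedOutcome hδ hY)).sub (memLp_const _))

lemma integral_eif_mul (hδ : 0 < δ) (hY : MemLp (fun z : Obs X => z.2) 2 (P : Measure (Obs X)))
    (hg : MemLp g 2 (P : Measure (Obs X))) :
    ∫ z, eif δ P z * g z ∂(P : Measure (Obs X)) =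
      ∑ t, ∫ z, treatmentCov P t g z * scaledOutcome δ P t z ∂(P : Measure (Obs X))
        + ∫ z, weightedOutcome δ P z * g z ∂(P : Measure (Obs X))
        - effect δ P * ∫ z, g z ∂(P : Measure (Obs X)) := by
  have hcorr : ∀ t ∈ Finset.univ,
      Integrable (fun z => correction δ P t z * g z) (P : Measure (Obs X)) := fun t _ =>
    integrable_mul_of_memLp_two (memLp_correction hδ hY t) hg
  have hout : Integrable (fun z => weightedOutcome δ P z * g z) (P : Measure (Obs X)) :=
    integrable_mul_of_memLp_two (memLp_weightedOutcome hδ hY) hg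
  have hsum := integrable_finsetSum _ hcorr
  have hsum_out : Integrable (fun z => ∑ t, correction δ P t z * g z + weightedOutcome δ P z * g z)
      (P : Measure (Obs X)) := hsum.add hout
  have hexpand : (fun z => eif δ P z * g z) =ᵐ[(P : Measure (Obs X))] fun z =>
      ∑ t, correction δ P t z * g z + weightedOutcome δ P z * g z - effect δ P * g z := by
    filter_upwards [eif_ae_eq hδ hY] with z hz
    rw [hz, sub_mul, add_mul, Finset.sum_mul]
  rw [integral_congr_ae hexpand, integral_sub hsum_out ((hg.integrable one_le_two).const_mul _),
    integral_add hsum hout, integral_finsetSum _ hcorr, integral_const_mul]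
  simp only [integral_correction_mul hδ hY hg]

lemma integral_eif (hδ : 0 < δ) (hY : MemLp (fun z : Obs X => z.2) 2 (P : Measure (Obs X))) :
    ∫ z, eif δ P z ∂(P : Measure (Obs X)) = 0 := by
  have hcov : ∀ t, ∫ z, treatmentCov P t (fun _ => 1) z * scaledOutcome δ P t z
      ∂(P : Measure (Obs X)) = 0 := fun t => by
    refine integral_eq_zero_of_ae ?_
    filter_upwards [(isCondExpFamily_propensity (fun _ => P) t).condCov_one] with z hz
    exact mul_eq_zero_of_left hz _
  have h := integral_eif_mul hδ hY (memLp_const 1)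
  simp only [mul_one, hcov, Finset.sum_const_zero, zero_add, integral_const, probReal_univ,
    smul_eq_mul] at h
  rw [h, effect_eq_integral hδ (hY.integrable one_le_two), sub_eq_zero]
  rfl

theorem hasDerivAt_effect (hδ : 0 < δ)
    (hY : MemLp (fun z : Obs X => z.2) 2 (P : Measure (Obs X)))
    {Q : ℝ → ProbabilityMeasure (Obs X)} (hQ : Submodel P Q g) :
    HasDerivAt (fun ε => effect δ (Q ε)) (∫ z, eif δ P z * g z ∂(P : Measure (Obs X))) 0 := by
  obtain ⟨hsub, C, hC⟩ := hQ
  obtain ⟨ν, r, g', hg, M⟩ := hsub.exists_rootModel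
  obtain rfl := hsub.base
  have hYr := M.l2Bounded_mul_root measurable_snd hC
  have heffect : (fun ε => effect δ (Q ε)) =ᶠ[𝓝 0] fun ε =>
      ∫ z, (∏ t, weight δ (Q ε) t z.1) * z.2 ∂(Q ε : Measure (Obs X)) :=
    hYr.memLp.mono fun ε hε =>
      effect_eq_integral hδ (((M.memLp_mul_iff measurable_snd).1 hε).integrable one_le_two)
  have hweights := HasL2Deriv.prod M Finset.univ fun t _ => hasL2Deriv_weight hδ M t
  refine ((M.hasDerivAt_integral_mul hweights measurable_snd hYr).congr_of_eventuallyEq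
    heffect).congr_deriv ?_
  have hcov : ∀ t ∈ Finset.univ, Integrable
      (fun z => treatmentCov (Q 0) t g' z * scaledOutcome δ (Q 0) t z)
      (Q 0 : Measure (Obs X)) := fun t _ =>
    integrable_mul_of_memLp_two (((isCondExpFamily_propensity Q t).memLp_residual_mul
      M.memLp_score 0).condExp one_le_two) (memLp_scaledOutcome hδ hY t)
  rw [integral_congr_ae (hg.mono fun z hz => congrArg (eif δ (Q 0) z * ·) hz),
    integral_eif_mul hδ hY M.memLp_score, M.integral_score, mul_zero, sub_zero,
    ← integral_finsetSum _ hcov]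
  congr 1
  refine integral_congr_ae (.of_forall fun z => ?_)
  dsimp only
  rw [Finset.mul_sum, Finset.sum_mul]
  refine Finset.sum_congr rfl fun t _ => ?_
  simp only [scaledOutcome, weightedOutcome]
  ring

theorem isEIF_eif (hδ : 0 < δ) (hY : MemLp (fun z : Obs X => z.2) 2 (P : Measure (Obs X))) :
    IsEIF (Submodel P) (effect δ) P (eif δ P) where
  memLp := memLp_eif hδ hY
  mean_zero := integral_eif hδ hY
  pathwise _ _ hQ := hasDerivAt_effect hδ hY hQ
  tangent _ hη := exists_mem_span_eLpNorm_sub_lt hY (memLp_eif hδ hY) (integral_eif hδ hY) hη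

end InfluenceFunction

end Incremental

theorem theorem2 {T : ℕ} {X : Fin T → Type*} [∀ t, MeasurableSpace (X t)]
    [∀ t, StandardBorelSpace (X t)] [∀ t, Nonempty (X t)]
    (P : ProbabilityMeasure (Incremental.Obs X))
    (hY : MemLp (fun z : Incremental.Obs X => z.2) 2 (P : Measure (Incremental.Obs X)))
    (δ : ℝ) (hδ : 0 < δ) :
    Efficiency.IsEIF (Incremental.Submodel P) (Incremental.effect δ) P (Incremental.eif δ P) ∧
      ∀ φ : Incremental.Obs X → ℝ,
        Efficiency.IsEIF (Incremental.Submodel P) (Incremental.effect δ) P φ →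
          φ =ᵐ[(P : Measure (Incremental.Obs X))] Incremental.eif δ P :=
  have heif := Incremental.isEIF_eif hδ hY
  ⟨heif, fun _ hφ => hφ.ae_eq (fun _ _ hQ => hQ.1.score_memLp) heif⟩
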